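/- Let $R$ be a commutative Noetherian henselian local ring and $\mathrm{mod}\,R$ the category of finitely generated $R$-modules. A subcategory of $\mathrm{mod}\,R$ means a full subcategory that is closed under isomorphisms, contains all finitely generated projective modules, and satisfies: $X\oplus Y\in\mathcal C$ if and only if $X\in\mathcal C$ and $Y\in\mathcal C$. It is called resolving if for every short exact sequence $0\to X\to Y\to Z\to 0$ in $\mathrm{mod}\,R$, $X,Z\in\mathcal C$ implies $Y\in\mathcal C$, and $Y,Z\in\mathcal C$ implies $X\in\mathcal C$. The stable category $\underline{\mathcal C}$ has the objects of $\mathcal C$ and the morphisms $\underline{\mathrm{Hom}}_R(X,Y)=\mathrm{Hom}_R(X,Y)/P(X,Y)$, where $P(X,Y)$ consists of the homomorphisms that factor through a projective module. Let $\mathrm{mod}\,\underline{\mathcal C}$ be the category of finitely presented contravariant additive functors $F$ from $\underline{\mathcal C}$ to abelian groups, i.e. those with an exact sequence $\underline{\mathrm{Hom}}_R(-,X_1)\to\underline{\mathrm{Hom}}_R(-,X_0)\to F\to 0$ with $X_0,X_1\in\underline{\mathcal C}$. A category is Frobenius if it is abelian with enough projectives and enough injectives and its projective objects are exactly its injective objects.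 Let $\mathcal G$ be the subcategory of modules of G-dimension zero: those $X\in\mathrm{mod}\,R$ with $\mathrm{Ext}^i_R(X,R)=0=\mathrm{Ext}^i_R(\mathrm{Tr}X,R)$ for all $i>0$, where $\mathrm{Tr}X=\mathrm{Coker}(\mathrm{Hom}_R(P_0,R)\to\mathrm{Hom}_R(P_1,R))$ for a presentation $P_1\to P_0\to X\to 0$ by finitely generated projective modules. (a) Suppose that (1) $\mathcal C$ is a resolving subcategory of $\mathrm{mod}\,R$; (2) $\mathrm{mod}\,\underline{\mathcal C}$ is a Frobenius category; (3) there is no nonprojective module $X\in\mathcal C$ with $\mathrm{Ext}^1_R(-,X)|_{\underline{\mathcal C}}=0$, i.e. with $\mathrm{Ext}^1_R(W,X)=0$ for all $W\in\mathcal C$. Then $\mathcal C\subseteq\mathcal G$. (b) Suppose that the Auslander–Reiten conjecture holds for $R$: every finitely generated $R$-module $X$ with $\mathrm{Ext}^i_R(X,X\oplus R)=0$ for all $i>0$ is projective. Then condition (3) holds for every $\mathcal C$ satisfying (1) and (2), and $\mathcal G$ is the largest resolving subcategory $\mathcal C$ of $\mathrm{mod}\,R$ for which $\mathrm{mod}\,\underline{\mathcal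 C}$ is a Frobenius category; that is, $\mathcal G$ itself is resolving with $\mathrm{mod}\,\underline{\mathcal G}$ Frobenius, and it contains every such $\mathcal C$. -/

import Mathlib

open CategoryTheory

universe u v w

/-! ### Finitely generated modules and their subcategories

`R` is a commutative ring (Noetherian in the theorem). A subcategory of `mod R` is given by the
class of its objects, a property of objects of `ModuleCat R` that implies finite generation; it is
automatically full. -/

section Subcategories

variable {R : Type u} [CommRing R]

/-- Subcategories of `mod R`: closed under isomorphisms, `X ⊕ Y` lies in `C` if and only if
both `X` and `Y` do, and all finitely generated projective modules lie in `C`. -/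
structure IsSubcategory (C : ObjectProperty (ModuleCat.{u} R)) : Prop where
  finite : ∀ X, C X → Module.Finite R X
  of_iso : ∀ X Y : ModuleCat.{u} R, Nonempty (X ≅ Y) → C X → C Y
  sum_iff : ∀ X Y : ModuleCat.{u} R, Module.Finite R X → Module.Finite R Y →
    (C (ModuleCat.of R (X × Y)) ↔ C X ∧ C Y)
  of_projective : ∀ P : ModuleCat.{u} R, Module.Finite R P → Module.Projective R P → C P

/-- Resolving subcategories of `mod R`: closed under extensions and under kernels of
epimorphisms, where all exact sequences are taken in `mod R`. -/
structure IsResolving (C : ObjectProperty (ModuleCat.{u} R)) : Prop extends IsSubcategory C where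
  ext_closed : ∀ S : ShortComplex (ModuleCat.{u} R), S.ShortExact →
    Module.Finite R S.X₁ → Module.Finite R S.X₂ → Module.Finite R S.X₃ →
    C S.X₁ → C S.X₃ → C S.X₂
  kernel_closed : ∀ S : ShortComplex (ModuleCat.{u} R), S.ShortExact →
    Module.Finite R S.X₁ → Module.Finite R S.X₂ → Module.Finite R S.X₃ →
    C S.X₂ → C S.X₃ → C S.X₁

end Subcategories

/-! ### The stable category -/

section Stable

variable {R : Type u} [CommRing R]

/-- The homomorphism `f` factors through a (finitely generated) projective module. -/
def FactorsThroughProjective {X Y : ModuleCat.{u} R} (f : X ⟶ Y) : Prop :=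
  ∃ (P : ModuleCat.{u} R) (g : X ⟶ P) (h : P ⟶ Y),
    Module.Finite R P ∧ Module.Projective R P ∧ g ≫ h = f

theorem FactorsThroughProjective.zero (X Y : ModuleCat.{u} R) :
    FactorsThroughProjective (0 : X ⟶ Y) :=
  ⟨ModuleCat.of R PUnit.{u + 1}, 0, 0, inferInstanceAs (Module.Finite R PUnit.{u + 1}),
    inferInstanceAs (Module.Projective R PUnit.{u + 1}), by simp⟩

theorem FactorsThroughProjective.neg {X Y : ModuleCat.{u} R} {f : X ⟶ Y}
    (hf : FactorsThroughProjective f) : FactorsThroughProjective (-f) := by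
  obtain ⟨P, g, h, h1, h2, rfl⟩ := hf
  exact ⟨P, -g, h, h1, h2, by simp⟩

theorem FactorsThroughProjective.add {X Y : ModuleCat.{u} R} {f f' : X ⟶ Y}
    (hf : FactorsThroughProjective f) (hf' : FactorsThroughProjective f') :
    FactorsThroughProjective (f + f') := by
  obtain ⟨P, g, h, h1, h2, rfl⟩ := hf
  obtain ⟨P', g', h', h1', h2', rfl⟩ := hf'
  refine ⟨ModuleCat.of R (P × P'), ModuleCat.ofHom (g.hom.prod g'.hom),
    ModuleCat.ofHom (h.hom.coprod h'.hom), inferInstanceAs (Module.Finite R (P × P')),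
    inferInstanceAs (Module.Projective R (P × P')), ?_⟩
  ext x
  simp

theorem FactorsThroughProjective.comp_left {X Y Z : ModuleCat.{u} R} (e : X ⟶ Y) {f : Y ⟶ Z}
    (hf : FactorsThroughProjective f) : FactorsThroughProjective (e ≫ f) := by
  obtain ⟨P, g, h, h1, h2, rfl⟩ := hf
  exact ⟨P, e ≫ g, h, h1, h2, by simp⟩

theorem FactorsThroughProjective.comp_right {X Y Z : ModuleCat.{u} R} {f : X ⟶ Y} (e : Y ⟶ Z)
    (hf : FactorsThroughProjective f) : FactorsThroughProjective (f ≫ e) := by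
  obtain ⟨P, g, h, h1, h2, rfl⟩ := hf
  exact ⟨P, g, h ≫ e, h1, h2, by simp⟩

/-- Two morphisms of `C` are identified when their difference factors through a projective. -/
def stableRel (C : ObjectProperty (ModuleCat.{u} R)) : HomRel C.FullSubcategory :=
  fun _ _ f g => FactorsThroughProjective (f.hom - g.hom)

instance stableRel_congruence (C : ObjectProperty (ModuleCat.{u} R)) :
    Congruence (stableRel C) where
  equivalence :=
    { refl := fun f => by
        simpa [stableRel] using FactorsThroughProjective.zero _ _
      symm := fun {f g} h => by
        have := FactorsThroughProjective.neg h
        simpa [stableRel] using this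
      trans := fun {f g k} h h' => by
        have := FactorsThroughProjective.add h h'
        simpa [stableRel] using this }
  comp_left := by
    intro _ _ _ e f g h
    have := FactorsThroughProjective.comp_left e.hom h
    simpa [stableRel, Preadditive.comp_sub] using this
  comp_right := by
    intro _ _ _ f g e h
    have := FactorsThroughProjective.comp_right e.hom h
    simpa [stableRel, Preadditive.sub_comp] using this

/-- The stable category of `C`: the objects are those of `C`, and the morphisms from `X` to `Y`
are `Hom_R(X, Y) / P(X, Y)`, where `P(X, Y)` consists of the homomorphisms that factor through
projective modules. -/
abbrev StableCategory (C : ObjectProperty (ModuleCat.{u} R)) : Type (u + 1) :=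
  Quotient (stableRel C)

instance stableCategory_preadditive (C : ObjectProperty (ModuleCat.{u} R)) :
    Preadditive (StableCategory C) :=
  Quotient.preadditive (stableRel C) (fun X Y f₁ f₂ g₁ g₂ h h' => by
    have := FactorsThroughProjective.add h h'
    have e : (f₁ + g₁).hom - (f₂ + g₂).hom = (f₁.hom - f₂.hom) + (g₁.hom - g₂.hom) := by
      change f₁.hom + g₁.hom - (f₂.hom + g₂.hom) = _
      abel
    simpa only [stableRel, e] using this)

end Stable

/-! ### Finitely presented functors and Frobenius categories -/

/-- A contravariant additive functor `F` from `A` to abelian groups is finitely presented if there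
is an exact sequence `Hom_A(-, X₁) ⟶ Hom_A(-, X₀) ⟶ F ⟶ 0`. -/
def IsFinitelyPresented (A : Type u) [Category.{v} A] [Preadditive A] :
    ObjectProperty (Aᵒᵖ ⥤ AddCommGrpCat.{v}) := fun F =>
  F.Additive ∧
    ∃ (X₁ X₀ : A) (f : preadditiveYoneda.obj X₁ ⟶ preadditiveYoneda.obj X₀)
      (p : preadditiveYoneda.obj X₀ ⟶ F),
      ∀ W : Aᵒᵖ, Function.Exact (f.app W).hom (p.app W).hom ∧
        Function.Surjective (p.app W).hom

/-- The category `mod A` of finitely presented contravariant additive functors from `A` to abelian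
groups, with all natural transformations as morphisms. -/
abbrev FinPresFunctors (A : Type u) [Category.{v} A] [Preadditive A] :=
  (IsFinitelyPresented A).FullSubcategory

/-- Frobenius categories: abelian categories with enough projectives and enough injectives in
which the projective objects are precisely the injective objects. -/
structure IsFrobeniusCategory (A : Type u) [Category.{v} A] : Prop where
  abelian : Nonempty (Abelian A)
  enoughProjectives : EnoughProjectives A
  enoughInjectives : EnoughInjectives A
  injective_of_projective : ∀ X : A, Projective X → Injective X
  projective_of_injective : ∀ X : A, Injective X → Projective X

/-! ### Modules of G-dimension zero -/

section GDimension

variable {R : Type u} [CommRing R]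

/-- A presentation `P₁ ⟶ P₀ ⟶ X ⟶ 0` by finitely generated projective modules. -/
structure FinProjPresentation (X : ModuleCat.{u} R) where
  (P₁ P₀ : ModuleCat.{u} R)
  d : P₁ ⟶ P₀
  e : P₀ ⟶ X
  finite₁ : Module.Finite R P₁
  finite₀ : Module.Finite R P₀
  projective₁ : Module.Projective R P₁
  projective₀ : Module.Projective R P₀
  exact : Function.Exact d.hom e.hom
  surjective : Function.Surjective e.hom

/-- The transpose of `X`: the cokernel of `Hom_R(P₀, R) ⟶ Hom_R(P₁, R)`. Different presentations
of `X` give transposes that agree up to projective direct summands. -/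
def FinProjPresentation.transpose {X : ModuleCat.{u} R} (p : FinProjPresentation X) :
    ModuleCat.{u} R :=
  ModuleCat.of R (Module.Dual R p.P₁ ⧸ LinearMap.range p.d.hom.dualMap)

/-- `Ext_R^i(X, Y) = 0`. -/
def ExtVanishes (X Y : ModuleCat.{u} R) (i : ℕ) : Prop :=
  Subsingleton (Abelian.Ext X Y i)

/-- The subcategory `𝒢` of modules of G-dimension zero: `X` is finitely generated and
`Ext_R^i(X, R) = 0 = Ext_R^i(Tr X, R)` for all `i > 0`. The vanishing for `Tr X` does not depend on
the presentation that defines `Tr X`, and over a Noetherian ring every finitely generated module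
has one. -/
def GDimZero (R : Type u) [CommRing R] : ObjectProperty (ModuleCat.{u} R) := fun X =>
  Module.Finite R X ∧ (∀ i : ℕ, 0 < i → ExtVanishes X (ModuleCat.of R R) i) ∧
    ∃ p : FinProjPresentation X, ∀ i : ℕ, 0 < i → ExtVanishes p.transpose (ModuleCat.of R R) i

/-- The assertion of the Auslander–Reiten conjecture for the ring `R`: a finitely generated module
`X` with `Ext_R^i(X, X ⊕ R) = 0` for all `i > 0` is projective. -/
def AuslanderReiten (R : Type u) [CommRing R] : Prop :=
  ∀ X : ModuleCat.{u} R, Module.Finite R X →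
    (∀ i : ℕ, 0 < i → ExtVanishes X (ModuleCat.of R (X × R)) i) → Module.Projective R X

/-- There is no nonprojective `X` in `C` with `Ext_R^1(-, X)` zero on `C`. -/
def NoExtInjectiveNonprojective (C : ObjectProperty (ModuleCat.{u} R)) : Prop :=
  ¬ ∃ X : ModuleCat.{u} R, C X ∧ ¬ Module.Projective R X ∧
    ∀ W : ModuleCat.{u} R, C W → ExtVanishes W X 1

end GDimension

/-! ### Henselian local rings: lifting factorizations and local endomorphism rings -/

section Henselian
open Polynomial IsLocalRing

/-! The Frobenius hypothesis is used only through two statements about maps of $\mathcal C$ modulo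
maps that factor through free modules. First, representable functors are injective, so every
monomorphism of $\underline{\mathcal C}$ splits (`IsResolving.exists_stable_retraction`). Second,
the cokernel of a map of representables embeds in a representable, so every map of $\mathcal C$ is
stably a weak kernel of some map $v$ (`IsResolving.exists_stable_weakCokernel`). Conversely, since a
resolving subcategory has stable weak kernels, these two statements imply that
$\mathrm{mod}\,\underline{\mathcal C}$ is Frobenius (`IsResolving.isFrobeniusCategory`).

G-dimension zero is the same as total reflexivity (`gDimZero_eq`), and a resolving $\mathcal C$
consists of totally reflexive modules once (i) $\mathrm{Ext}^i(X,R)=0$ for all $X\in\mathcal C$,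
$i>0$, and (ii) every $X\in\mathcal C$ embeds in a finite projective module with cokernel in
$\mathcal C$.

For (i), take $0\to R\to Y\to X\to 0$. Its kernel is free, so $Y\to X$ is a stable monomorphism and
splits stably. On the part of $Y$ without free summands Nakayama turns this into a true splitting;
removing that part leaves $0\to R\to R^n\to X'\to 0$ with $X'\in\mathcal C$ of projective dimension
at most one. Such an $X'$ is projective: after free summands are removed, its self-extensions split
by the same argument, and vanishing of $\mathrm{Ext}^1(X',X')$ makes the resolution of $X'$ split.
Higher Ext follows by dimension shifting.

For (ii), it suffices to treat an indecomposable nonprojective $X$. Condition (3) supplies a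
nonsplit $0\to X\to Y\to W\to 0$. If $Y\to W$ is a weak kernel of $v:W\to V$, this sequence maps to
and from the pullback along $v$ of a free cover of $V$. Because $R$ is henselian, $\mathrm{End}(X)$
is local, so either $X$ is a summand of the syzygy $\Omega V$ or the sequence splits; only the
former is possible.

In (b), a counterexample $X$ to (3) has $\mathrm{Ext}^i(X,X)=0$ by dimension shifting and
$\mathrm{Ext}^i(X,R)=0$ by (i), whose proof does not use (3); the Auslander–Reiten conjecture makes
it projective. That $\mathcal G$ itself qualifies is verified through the same two statements about
stable maps, using cosyzygies of totally reflexive modules. -/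

theorem exists_algHom_away {R A B : Type*} [CommRing R] [CommRing A] [CommRing B] [Algebra R A]
    [Algebra A B] [Algebra R B] [IsScalarTower R A B] {f : A} (hf : IsUnit (algebraMap A B f)) :
    ∃ φ : Localization.Away f →ₐ[R] B,
      φ.comp (IsScalarTower.toAlgHom R A (Localization.Away f)) =
        IsScalarTower.toAlgHom R A B :=
  ⟨IsLocalization.Away.liftAlgHom (f := IsScalarTower.toAlgHom R A B) f hf, by
    ext x
    exact IsLocalization.Away.lift_eq f hf x⟩

/-- An étale neighbourhood of the closed point of a henselian local ring has a section. -/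
theorem HenselianLocalRing.exists_algHom_of_etale {R R' : Type u} [CommRing R]
    [HenselianLocalRing R] [CommRing R'] [Algebra R R'] [Algebra.Etale R R'] (Q : Ideal R')
    [Q.IsPrime] [Q.LiesOver (maximalIdeal R)]
    (hQ : Function.Surjective (algebraMap R Q.ResidueField)) :
    ∃ s : R' →ₐ[R] R, (Algebra.ofId R Q.ResidueField).comp s =
      IsScalarTower.toAlgHom R R' Q.ResidueField := by
  -- After inverting `f` the algebra is standard étale, so a section amounts to a root of `P.f` at
  -- which `P.g` is a unit.
  obtain ⟨f, hfQ, ⟨⟨P⟩⟩⟩ := Algebra.IsEtaleAt.exists_isStandardEtale (R := R) Q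
  have hunit : IsUnit (algebraMap R' Q.ResidueField f) := by
    rw [isUnit_iff_ne_zero]
    exact fun h => hfQ (Ideal.algebraMap_residueField_eq_zero.mp h)
  have hm : ∀ r : R, algebraMap R Q.ResidueField r = 0 ↔ r ∈ maximalIdeal R := by
    intro r
    rw [IsScalarTower.algebraMap_apply R R' Q.ResidueField, Ideal.algebraMap_residueField_eq_zero,
      ← Ideal.mem_comap, Ideal.over_def Q (maximalIdeal R)]
  have hu : ∀ r : R, IsUnit (algebraMap R Q.ResidueField r) ↔ IsUnit r := by
    intro r
    rw [isUnit_iff_ne_zero, Ne, hm, ← notMem_maximalIdeal]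
  obtain ⟨φ, hφ⟩ : ∃ φ : Localization.Away f →ₐ[R] Q.ResidueField,
      φ.comp (IsScalarTower.toAlgHom R R' (Localization.Away f)) =
        IsScalarTower.toAlgHom R R' Q.ResidueField :=
    exists_algHom_away hunit
  obtain ⟨r₀, hr₀⟩ := hQ (φ P.x)
  have hx := P.hasMap.map φ
  have hx' := hx.isUnit_derivative_f
  have hae : ∀ (p : R[X]) (r : R), aeval (algebraMap R Q.ResidueField r) p =
      algebraMap R Q.ResidueField (p.eval r) := fun p r => by
    rw [aeval_algebraMap_apply]; simp
  -- The class of `r₀` is a simple root of `P.f` in the residue field, because the derivative is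
  -- invertible in a standard étale algebra.
  obtain ⟨r, hr, hrr⟩ := HenselianLocalRing.is_henselian P.f P.monic_f r₀
    ((hm _).mp (by rw [← hae, hr₀]; exact hx.1))
    ((hu _).mp (by rw [← hae, hr₀]; exact hx'))
  have hrφ : algebraMap R Q.ResidueField r = φ P.x := by
    rw [← hr₀, ← sub_eq_zero, ← map_sub, hm]; exact hrr
  have hmap : P.HasMap r := by
    refine ⟨by simpa using hr, ?_⟩
    have := (hu (P.g.eval r)).mp (by rw [← hae, hrφ]; exact hx.2)
    simpa using this
  refine ⟨((P.lift r hmap).comp P.equivRing.toAlgHom).comp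
    (IsScalarTower.toAlgHom R R' (Localization.Away f)), ?_⟩
  rw [← hφ, ← AlgHom.comp_assoc]
  congr 1
  apply P.hom_ext
  simp [StandardEtalePair.lift_X, hrφ, Algebra.ofId_apply]

/-- Over a henselian local ring, coprime factorizations of monic polynomials lift. -/
theorem HenselianLocalRing.exists_factorization {R : Type u} [CommRing R] [HenselianLocalRing R]
    (p : R[X]) (hp : p.Monic) (f g : (maximalIdeal R).ResidueField[X]) (hf : f.Monic) (hg : g.Monic)
    (H : p.map (algebraMap R _) = f * g) (hfg : IsCoprime f g) :
    ∃ F G : R[X], p = F * G ∧ IsCoprime F G ∧ F.map (algebraMap R _) = f ∧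
      G.map (algebraMap R _) = g := by
  -- The factorization already lifts to an étale algebra with a point of trivial residue extension;
  -- a section of that algebra carries it to `R`.
  obtain ⟨R', _, _, _, Q, _, _, f', g', hbij, hf', hg', hpfg, hc, hff', hgg'⟩ :=
    Algebra.exists_etale_bijective_residueFieldMap_and_map_eq_mul_and_isCoprime
      (maximalIdeal R) p f g hp hf hg H hfg
  have hsurj : Function.Surjective (algebraMap R Q.ResidueField) := by
    have h1 : Function.Surjective (algebraMap R (maximalIdeal R).ResidueField) :=
      Ideal.algebraMap_residueField_surjective _
    have := hbij.2.comp h1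
    convert this using 1
    ext x
    simp
  obtain ⟨s, hs⟩ := HenselianLocalRing.exists_algHom_of_etale Q hsurj
  have key : ∀ (q : (maximalIdeal R).ResidueField[X]) (q' : R'[X]),
      q.map (Ideal.ResidueField.mapₐ (maximalIdeal R) Q (Algebra.ofId _ _)
        (Ideal.over_def Q (maximalIdeal R))).toRingHom = q'.map (algebraMap _ _) →
      (q'.map s.toRingHom).map (algebraMap R _) = q := by
    intro q q' h
    apply Polynomial.map_injective _ hbij.1
    rw [Polynomial.map_map]
    refine Eq.trans ?_ h.symm
    rw [Polynomial.map_map]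
    congr 1
    ext x
    have := DFunLike.congr_fun hs x
    simpa using this
  refine ⟨f'.map s.toRingHom, g'.map s.toRingHom, ?_, ?_, key _ _ hff', key _ _ hgg'⟩
  · rw [← Polynomial.map_mul, ← hpfg, Polynomial.map_map]
    have : s.toRingHom.comp (algebraMap R R') = RingHom.id R := by
      ext x; simp
    rw [this, Polynomial.map_id]
  · exact hc.map (Polynomial.mapRingHom s.toRingHom)

/-- A finite module over a henselian local ring without nontrivial idempotent endomorphisms has a
local endomorphism ring. -/
theorem HenselianLocalRing.isUnit_or_isUnit_one_sub {R : Type u} [CommRing R]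
    [HenselianLocalRing R] {M : Type v} [AddCommGroup M] [Module R M] [Module.Finite R M]
    (hM : ∀ e : Module.End R M, e * e = e → e = 0 ∨ e = 1) (φ : Module.End R M) :
    IsUnit φ ∨ IsUnit (1 - φ) := by
  obtain ⟨p, hp, hpφ⟩ := Algebra.IsIntegral.isIntegral (R := R) φ
  change aeval φ p = 0 at hpφ
  set k := (maximalIdeal R).ResidueField
  -- Modulo the maximal ideal, the nilpotent part $X^n$ of `p` is separated from the part `q` with
  -- $q(0)\neq 0$; lifting this to `p = F * G` produces an idempotent in $R[\varphi]$.
  obtain ⟨q, hq, hq'⟩ := (p.map (algebraMap R k)).exists_eq_pow_rootMultiplicity_mul_and_not_dvd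
    (hp.map _).ne_zero 0
  set n := (p.map (algebraMap R k)).rootMultiplicity 0
  rw [C_0, sub_zero] at hq hq'
  have hqm : q.Monic := (monic_X_pow n).of_mul_monic_left (hq ▸ hp.map _)
  have hcop : IsCoprime (X ^ n) q := by
    apply IsCoprime.pow_left
    exact (Irreducible.coprime_iff_not_dvd irreducible_X).mpr hq'
  obtain ⟨F, G, hFG, ⟨a, b, hab⟩, hF, hG⟩ :=
    HenselianLocalRing.exists_factorization p hp _ _ (monic_X_pow n) hqm hq hcop
  have hunit : ∀ r : R, algebraMap R k r ≠ 0 → IsUnit r := by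
    intro r hr
    rw [← notMem_maximalIdeal]
    exact fun h => hr (Ideal.algebraMap_residueField_eq_zero.mpr h)
  have hroot : ∀ (P : R[X]) (r : R), aeval φ P = 0 → IsUnit (P.eval r) →
      IsUnit (φ - algebraMap R _ r) := by
    intro P r h0 hu
    -- Since $X-r$ divides $P-P(r)$ and $P(\varphi)=0$, the unit $-P(r)$ is a multiple of
    -- $\varphi-r$.
    obtain ⟨S, hS⟩ := X_sub_C_dvd_sub_C_eval (a := r) (p := P)
    have h1 : (φ - algebraMap R _ r) * aeval φ S = - algebraMap R _ (P.eval r) := by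
      have := congrArg (aeval φ) hS
      simpa [h0] using this.symm
    have h2 : aeval φ S * (φ - algebraMap R _ r) = - algebraMap R _ (P.eval r) := by
      rw [← h1]
      have : φ - algebraMap R _ r = aeval φ (X - C r) := by simp
      rw [this, ← map_mul, ← map_mul, mul_comm]
    have h3 : IsUnit (- algebraMap R (Module.End R M) (P.eval r)) := (hu.map _).neg
    have hc : Commute (φ - algebraMap R _ r) (aeval φ S) := h1.trans h2.symm
    exact (hc.isUnit_mul_iff.mp (h1 ▸ h3)).1
  have hz : aeval φ F * aeval φ G = 0 := by rw [← map_mul, ← hFG, hpφ]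
  have hone : aeval φ a * aeval φ F + aeval φ b * aeval φ G = 1 := by
    rw [← map_mul, ← map_mul, ← map_add, hab, map_one]
  have hcomm : ∀ P Q : R[X], aeval φ P * aeval φ Q = aeval φ Q * aeval φ P := fun P Q => by
    rw [← map_mul, ← map_mul, mul_comm]
  have hidem : (aeval φ a * aeval φ F) * (aeval φ a * aeval φ F) = aeval φ a * aeval φ F := by
    have : (aeval φ a * aeval φ F) * (aeval φ b * aeval φ G) = 0 := by
      rw [← map_mul, ← map_mul, ← map_mul, show a * F * (b * G) = a * b * (F * G) by ring, ← hFG,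
        map_mul, hpφ, mul_zero]
    calc _ = (aeval φ a * aeval φ F) * (aeval φ a * aeval φ F + aeval φ b * aeval φ G) := by
          rw [mul_add, this, add_zero]
      _ = _ := by rw [hone, mul_one]
  rcases hM _ hidem with h | h
  -- Here $F(\varphi)=0$, and $F(1)$ is a unit because $F\equiv X^n$.
  · right
    have hF0 : aeval φ F = 0 := by
      rw [h, zero_add] at hone
      calc aeval φ F = aeval φ F * (aeval φ b * aeval φ G) := by rw [hone, mul_one]
        _ = 0 := by rw [← mul_assoc, hcomm F b, mul_assoc, hz, mul_zero]
    have := (hroot F 1 hF0 (hunit _ (by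
      have := congrArg (Polynomial.eval 1) hF
      rw [← map_one (algebraMap R k), eval_map_algebraMap, aeval_algebraMap_apply] at this
      simp only [eval_pow, eval_X, map_one, one_pow, coe_aeval_eq_eval] at this
      rw [this]
      exact one_ne_zero))).neg
    simpa using this
  -- Here $G(\varphi)=0$, and $G(0)$ is a unit because $X$ does not divide `q`.
  · left
    have hG0 : aeval φ G = 0 := by
      calc aeval φ G = (aeval φ a * aeval φ F) * aeval φ G := by rw [h, one_mul]
        _ = 0 := by rw [mul_assoc, hz, mul_zero]
    have := hroot G 0 hG0 (hunit _ (by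
      have := congrArg (Polynomial.eval 0) hG
      rw [← map_zero (algebraMap R k), eval_map_algebraMap, aeval_algebraMap_apply] at this
      rw [coe_aeval_eq_eval, map_zero] at this
      intro h0
      rw [h0] at this
      exact hq' (X_dvd_iff.mpr (by rw [coeff_zero_eq_eval_zero]; exact this.symm))))
    simpa using this

end Henselian

/-! ### Finite modules over local rings and maps that factor through free modules -/

section LocalModules
open IsLocalRing

variable {R : Type u} [CommRing R]

/-- A retraction splits off a direct summand. -/
def LinearMap.equivKerProdOfLeftInverse {M N : Type*} [AddCommGroup M] [Module R M]
    [AddCommGroup N] [Module R N] (i : N →ₗ[R] M) (r : M →ₗ[R] N) (h : ∀ x, r (i x) = x) :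
    M ≃ₗ[R] LinearMap.ker r × N where
  toFun m := (⟨m - i (r m), by simp [h]⟩, r m)
  invFun x := x.1 + i x.2
  map_add' x y := by ext <;> simp; abel
  map_smul' c x := by ext <;> simp [smul_sub]
  left_inv x := by simp
  right_inv x := by
    have := x.1.2
    ext <;> simp [h]

/-- A linear map that factors through a finite free module. -/
def LinearMap.IsStablyZero {M N : Type*} [AddCommGroup M] [Module R M]
    [AddCommGroup N] [Module R N] (f : M →ₗ[R] N) : Prop :=
  ∃ (n : ℕ) (a : M →ₗ[R] (Fin n → R)) (b : (Fin n → R) →ₗ[R] N), b ∘ₗ a = f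

/-- A module over a local ring without free direct summands. -/
def NoFreeSummand (R : Type u) [CommRing R] [IsLocalRing R] (M : Type*) [AddCommGroup M]
    [Module R M] : Prop :=
  ∀ (f : M →ₗ[R] R) (x : M), f x ∈ maximalIdeal R

/-- A module whose only idempotent endomorphisms are `0` and `1`. -/
def IsIndecomposableModule (R : Type u) [CommRing R] (M : Type*) [AddCommGroup M]
    [Module R M] : Prop :=
  ∀ e : Module.End R M, e * e = e → e = 0 ∨ e = 1

theorem finrank_residueField_tensor_prod [IsLocalRing R] (M N : Type*) [AddCommGroup M]
    [Module R M] [AddCommGroup N] [Module R N] [Module.Finite R M] [Module.Finite R N] :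
    Module.finrank (ResidueField R) (TensorProduct R (ResidueField R) (M × N)) =
      Module.finrank (ResidueField R) (TensorProduct R (ResidueField R) M) +
      Module.finrank (ResidueField R) (TensorProduct R (ResidueField R) N) := by
  rw [← Module.finrank_prod]
  exact (TensorProduct.prodRight R (ResidueField R) (ResidueField R) M N).finrank_eq

theorem finrank_residueField_tensor_pos [IsLocalRing R] (M : Type*) [AddCommGroup M]
    [Module R M] [Module.Finite R M] [Nontrivial M] :
    0 < Module.finrank (ResidueField R) (TensorProduct R (ResidueField R) M) := by
  rw [Module.finrank_pos_iff]
  by_contra h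
  rw [not_nontrivial_iff_subsingleton] at h
  exact not_subsingleton M ((IsLocalRing.subsingleton_tensorProduct (R := R)).mp h)

/-- Every finite module over a local ring is the direct sum of a free module and a module without
free direct summands. -/
theorem exists_noFreeSummand_prod_free [IsLocalRing R] (M : Type u) [AddCommGroup M] [Module R M]
    [Module.Finite R M] : ∃ (M₀ : ModuleCat.{u} R) (n : ℕ),
      Module.Finite R M₀ ∧ NoFreeSummand R M₀ ∧ Nonempty (M ≃ₗ[R] M₀ × (Fin n → R)) := by
  induction h : Module.finrank (ResidueField R) (TensorProduct R (ResidueField R) M)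
    using Nat.strong_induction_on generalizing M with
  | _ d ih =>
  subst h
  by_cases hM : NoFreeSummand R M
  · exact ⟨ModuleCat.of R M, 0, ‹_›, hM, ⟨LinearEquiv.prodUnique.symm⟩⟩
  · simp only [NoFreeSummand, not_forall, notMem_maximalIdeal] at hM
    obtain ⟨f, x, hx⟩ := hM
    obtain ⟨c, hc⟩ := hx
    have e := LinearMap.equivKerProdOfLeftInverse (LinearMap.toSpanSingleton R M ((↑c⁻¹ : R) • x)) f
      (fun y => by simp [← hc])
    have : Module.Finite R (LinearMap.ker f) :=
      Module.Finite.of_surjective ((LinearMap.fst R (LinearMap.ker f) R) ∘ₗ e.toLinearMap)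
        (Prod.fst_surjective.comp e.surjective)
    have hlt := finrank_residueField_tensor_prod (R := R) (LinearMap.ker f) R
    rw [← (e.baseChange R (ResidueField R) M _).finrank_eq] at hlt
    have := finrank_residueField_tensor_pos (R := R) R
    obtain ⟨M₀, n, h1, h2, ⟨e'⟩⟩ := ih _ (by omega) (LinearMap.ker f) rfl
    refine ⟨M₀, n + 1, h1, h2, ⟨e ≪≫ₗ (e'.prodCongr (LinearEquiv.refl R R)) ≪≫ₗ
      LinearEquiv.prodAssoc R M₀ (Fin n → R) R ≪≫ₗ
      (LinearEquiv.refl R M₀).prodCongr (LinearEquiv.prodComm R _ _ ≪≫ₗ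
        Fin.consLinearEquiv R (fun _ => R))⟩⟩

/-- Every finite module over a local ring is a finite direct sum of indecomposable modules. -/
theorem induction_of_indecomposable [IsLocalRing R] {P : ModuleCat.{u} R → Prop}
    (equiv : ∀ M N : ModuleCat.{u} R, (M ≃ₗ[R] N) → P M → P N)
    (indecomposable : ∀ M : ModuleCat.{u} R, Module.Finite R M → IsIndecomposableModule R M → P M)
    (prod : ∀ M N : ModuleCat.{u} R, Module.Finite R M → Module.Finite R N → P M → P N →
      P (ModuleCat.of R (M × N)))
    (M : ModuleCat.{u} R) [Module.Finite R M] : P M := by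
  induction h : Module.finrank (ResidueField R) (TensorProduct R (ResidueField R) M)
    using Nat.strong_induction_on generalizing M with
  | _ d ih =>
  subst h
  by_cases hM : IsIndecomposableModule R M
  · exact indecomposable M ‹_› hM
  · simp only [IsIndecomposableModule, not_forall, not_or] at hM
    obtain ⟨e, he, h0, h1⟩ := hM
    have hee : ∀ x, e (e x) = e x := fun x => LinearMap.congr_fun he x
    have E := LinearMap.equivKerProdOfLeftInverse (LinearMap.range e).subtype e.rangeRestrict
      (by rintro ⟨_, x, rfl⟩; ext; simp [hee])
    have f1 : Module.Finite R (LinearMap.ker e.rangeRestrict) :=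
      Module.Finite.of_surjective (LinearMap.fst R _ _ ∘ₗ E.toLinearMap)
        (Prod.fst_surjective.comp E.surjective)
    have f2 : Module.Finite R (LinearMap.range e) := inferInstance
    have n1 : Nontrivial (LinearMap.ker e.rangeRestrict) := by
      rw [Submodule.nontrivial_iff_ne_bot]
      intro hk
      apply h1
      ext x
      have : x - e x ∈ LinearMap.ker e.rangeRestrict := by
        rw [LinearMap.ker_rangeRestrict, LinearMap.mem_ker, map_sub, hee, sub_self]
      rw [hk, Submodule.mem_bot, sub_eq_zero] at this
      exact this.symm
    have n2 : Nontrivial (LinearMap.range e) := by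
      rw [Submodule.nontrivial_iff_ne_bot]
      exact fun hk => h0 (LinearMap.range_eq_bot.mp hk)
    have hlt := finrank_residueField_tensor_prod (R := R) (LinearMap.ker e.rangeRestrict)
      (LinearMap.range e)
    rw [← (E.baseChange R (ResidueField R) M _).finrank_eq] at hlt
    have p1 := finrank_residueField_tensor_pos (R := R) (LinearMap.ker e.rangeRestrict)
    have p2 := finrank_residueField_tensor_pos (R := R) (LinearMap.range e)
    exact equiv _ _ E.symm (prod (ModuleCat.of R (LinearMap.ker e.rangeRestrict))
      (ModuleCat.of R (LinearMap.range e)) f1 f2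
      (ih _ (by dsimp only [ModuleCat.of_coe] at *; omega) (ModuleCat.of R _) rfl)
      (ih _ (by dsimp only [ModuleCat.of_coe] at *; omega) (ModuleCat.of R _) rfl))

/-- Nakayama: an endomorphism congruent to the identity modulo the maximal ideal is bijective. -/
theorem LinearMap.bijective_of_sub_mem [IsLocalRing R] {M : Type*} [AddCommGroup M] [Module R M]
    [Module.Finite R M] (g : M →ₗ[R] M) (h : ∀ x, g x - x ∈ maximalIdeal R • (⊤ : Submodule R M)) :
    Function.Bijective g := by
  have hs : Function.Surjective g := by
    rw [← LinearMap.range_eq_top]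
    have := Submodule.le_of_le_smul_of_le_jacobson_bot (I := maximalIdeal R)
      (N := LinearMap.range g) (N' := ⊤) Module.Finite.fg_top
      (by rw [IsLocalRing.jacobson_eq_maximalIdeal _ bot_ne_top])
      (by
        intro x _
        have h1 := h x
        rw [← neg_mem_iff, neg_sub] at h1
        have : x = g x + (x - g x) := by abel
        rw [this]
        exact Submodule.add_mem_sup ⟨x, rfl⟩ h1)
    exact top_le_iff.mp this
  exact ⟨OrzechProperty.injective_of_surjective_endomorphism g hs, hs⟩

/-- The components of a map to $R^n$ are functionals on `M`, which take no unit values. -/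
theorem LinearMap.IsStablyZero.apply_mem [IsLocalRing R] {M N : Type*} [AddCommGroup M] [Module R M]
    [AddCommGroup N] [Module R N] (hM : NoFreeSummand R M) {f : M →ₗ[R] N} (hf : f.IsStablyZero)
    (x : M) : f x ∈ maximalIdeal R • (⊤ : Submodule R N) := by
  obtain ⟨n, a, b, rfl⟩ := hf
  rw [LinearMap.comp_apply, LinearMap.pi_apply_eq_sum_univ b]
  exact Submodule.sum_mem _ fun i _ =>
    Submodule.smul_mem_smul (hM (LinearMap.proj i ∘ₗ a) x) Submodule.mem_top

/-- This lifts stable retractions to honest ones: a stable identity is the identity modulo the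
maximal ideal, so Nakayama applies. -/
theorem LinearMap.IsStablyZero.bijective_of_sub_id [IsLocalRing R] {M : Type*} [AddCommGroup M]
    [Module R M] [Module.Finite R M] (hM : NoFreeSummand R M) {g : M →ₗ[R] M}
    (hg : (g - LinearMap.id).IsStablyZero) : Function.Bijective g :=
  g.bijective_of_sub_mem fun x => hg.apply_mem hM x

namespace LinearMap.IsStablyZero

variable {M N L : Type*} [AddCommGroup M] [Module R M] [AddCommGroup N] [Module R N]
  [AddCommGroup L] [Module R L]

theorem comp_left {f : M →ₗ[R] N} (hf : f.IsStablyZero) (g : N →ₗ[R] L) :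
    (g ∘ₗ f).IsStablyZero := by
  obtain ⟨n, a, b, rfl⟩ := hf
  exact ⟨n, a, g ∘ₗ b, rfl⟩

theorem comp_right {g : N →ₗ[R] L} (hg : g.IsStablyZero) (f : M →ₗ[R] N) :
    (g ∘ₗ f).IsStablyZero := by
  obtain ⟨n, a, b, rfl⟩ := hg
  exact ⟨n, a ∘ₗ f, b, rfl⟩

theorem id_of_projective (P : Type*) [AddCommGroup P] [Module R P] [Module.Finite R P]
    [Module.Projective R P] : (LinearMap.id : P →ₗ[R] P).IsStablyZero := by
  obtain ⟨n, f, g, _, _, h⟩ := Module.Finite.exists_comp_eq_id_of_projective R P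
  exact ⟨n, g, f, h⟩

theorem of_projective_source {P : Type*} [AddCommGroup P] [Module R P] [Module.Finite R P]
    [Module.Projective R P] (f : P →ₗ[R] N) : f.IsStablyZero :=
  (id_of_projective P).comp_left f

theorem of_projective_target {P : Type*} [AddCommGroup P] [Module R P] [Module.Finite R P]
    [Module.Projective R P] (f : N →ₗ[R] P) : f.IsStablyZero :=
  (id_of_projective P).comp_right f

end LinearMap.IsStablyZero

theorem factorsThroughProjective_iff {X Y : ModuleCat.{u} R} (f : X ⟶ Y) :
    FactorsThroughProjective f ↔ f.hom.IsStablyZero := by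
  constructor
  · rintro ⟨P, g, h, _, _, rfl⟩
    exact (LinearMap.IsStablyZero.of_projective_source h.hom).comp_right g.hom
  · rintro ⟨n, a, b, h⟩
    exact ⟨ModuleCat.of R (Fin n → R), ModuleCat.ofHom a, ModuleCat.ofHom b,
      inferInstanceAs (Module.Finite R (Fin n → R)),
      inferInstanceAs (Module.Projective R (Fin n → R)), by ext x; exact LinearMap.congr_fun h x⟩

theorem LinearMap.IsStablyZero.add {X Y : Type u} [AddCommGroup X] [Module R X] [AddCommGroup Y]
    [Module R Y] {f g : X →ₗ[R] Y} (hf : f.IsStablyZero) (hg : g.IsStablyZero) :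
    (f + g).IsStablyZero :=
  (factorsThroughProjective_iff (ModuleCat.ofHom f + ModuleCat.ofHom g)).mp
    (((factorsThroughProjective_iff (ModuleCat.ofHom f)).mpr hf).add
      ((factorsThroughProjective_iff (ModuleCat.ofHom g)).mpr hg))

end LocalModules

/-! ### Short exact sequences and vanishing of Ext -/

section ExtCriteria
open Abelian

variable {R : Type u} [CommRing R]

/-- Short exact sequences of modules. -/
structure IsShortExactPair {A B W : Type*} [AddCommGroup A] [Module R A] [AddCommGroup B]
    [Module R B] [AddCommGroup W] [Module R W] (i : A →ₗ[R] B) (p : B →ₗ[R] W) : Prop where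
  injective : Function.Injective i
  exact : Function.Exact i p
  surjective : Function.Surjective p

namespace IsShortExactPair

section
variable {A B W : Type*} [AddCommGroup A] [Module R A] [AddCommGroup B]
    [Module R B] [AddCommGroup W] [Module R W] {i : A →ₗ[R] B} {p : B →ₗ[R] W}

theorem of_surjective (p : B →ₗ[R] W) (hp : Function.Surjective p) :
    IsShortExactPair (LinearMap.ker p).subtype p :=
  ⟨Subtype.coe_injective, LinearMap.exact_subtype_ker_map p, hp⟩

theorem apply_apply (h : IsShortExactPair i p) (x : A) : p (i x) = 0 := h.exact.apply_apply_eq_zero x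

/-- A map into the middle term that vanishes in the quotient factors through the kernel. -/
theorem exists_lift (h : IsShortExactPair i p) {U : Type*} [AddCommGroup U] [Module R U]
    (g : U →ₗ[R] B) (hg : ∀ x, p (g x) = 0) : ∃ f : U →ₗ[R] A, ∀ x, i (f x) = g x := by
  have hr : ∀ x, g x ∈ LinearMap.range i := fun x => (h.exact (g x)).mp (hg x)
  let e := LinearEquiv.ofInjective i h.injective
  refine ⟨e.symm.toLinearMap ∘ₗ g.codRestrict (LinearMap.range i) hr, fun x => ?_⟩
  exact congrArg Subtype.val (e.apply_symm_apply (g.codRestrict (LinearMap.range i) hr x))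

/-- A map from the middle term that vanishes on the kernel factors through the quotient. -/
theorem exists_desc (h : IsShortExactPair i p) {U : Type*} [AddCommGroup U] [Module R U]
    (g : B →ₗ[R] U) (hg : ∀ x, g (i x) = 0) : ∃ f : W →ₗ[R] U, ∀ x, f (p x) = g x := by
  let e := p.quotKerEquivOfSurjective h.surjective
  refine ⟨(LinearMap.ker p).liftQ g ?_ ∘ₗ e.symm.toLinearMap, fun x => ?_⟩
  · intro x hx
    obtain ⟨y, rfl⟩ := (h.exact x).mp hx
    exact hg y
  · have : e.symm (p x) = (LinearMap.ker p).mkQ x := by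
      rw [LinearEquiv.symm_apply_eq]; rfl
    simp [this]

theorem finite_left [IsNoetherianRing R] [Module.Finite R B] (h : IsShortExactPair i p) :
    Module.Finite R A :=
  Module.Finite.of_injective i h.injective

theorem finite_middle [Module.Finite R A] [Module.Finite R W] (h : IsShortExactPair i p) :
    Module.Finite R B :=
  Module.Finite.of_exact h.exact h.surjective

/-- A retraction of the kernel inclusion splits a short exact sequence. -/
theorem equiv_of_retraction (h : IsShortExactPair i p) (r : B →ₗ[R] A) (hr : ∀ x, r (i x) = x) :
    Nonempty (B ≃ₗ[R] A × W) := by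
  refine ⟨LinearEquiv.ofBijective (r.prod p) ⟨?_, ?_⟩⟩
  · rw [← LinearMap.ker_eq_bot, LinearMap.ker_eq_bot']
    intro x hx
    have h1 : r x = 0 := congrArg Prod.fst hx
    have h2 : p x = 0 := congrArg Prod.snd hx
    obtain ⟨y, rfl⟩ := (h.exact x).mp h2
    rw [← hr y, h1, map_zero]
  · rintro ⟨a, w⟩
    obtain ⟨b, rfl⟩ := h.surjective w
    exact ⟨b + i (a - r b), by simp [hr, h.apply_apply]⟩

theorem equiv_of_projective (h : IsShortExactPair i p) [Module.Projective R W] :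
    Nonempty (B ≃ₗ[R] A × W) := by
  obtain ⟨s, hs⟩ := Module.projective_lifting_property p LinearMap.id h.surjective
  obtain ⟨r, hr⟩ := h.exists_lift (LinearMap.id - s ∘ₗ p) (fun x => by
    have := LinearMap.congr_fun hs (p x)
    simp only [LinearMap.comp_apply, LinearMap.id_apply] at this
    simp [this])
  refine h.equiv_of_retraction r fun x => h.injective ?_
  simp [hr, h.apply_apply]

end

section
variable {A B W : ModuleCat.{u} R} {i : A →ₗ[R] B} {p : B →ₗ[R] W}

/-- The associated short complex. -/
abbrev shortComplex (h : IsShortExactPair i p) : ShortComplex (ModuleCat.{u} R) :=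
  ShortComplex.mk (ModuleCat.ofHom i) (ModuleCat.ofHom p) (by ext x; exact h.apply_apply x)

theorem shortExact (h : IsShortExactPair i p) : h.shortComplex.ShortExact where
  exact := (ShortComplex.ShortExact.moduleCat_exact_iff_function_exact _).mpr h.exact
  mono_f := (ModuleCat.mono_iff_injective _).mpr h.injective
  epi_g := (ModuleCat.epi_iff_surjective _).mpr h.surjective

theorem of_shortExact {S : ShortComplex (ModuleCat.{u} R)} (hS : S.ShortExact) :
    IsShortExactPair S.f.hom S.g.hom :=
  ⟨hS.moduleCat_injective_f, (ShortComplex.ShortExact.moduleCat_exact_iff_function_exact _).mp hS.exact,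
    hS.moduleCat_surjective_g⟩

/-- If `Ext¹(W, X) = 0`, maps into `X` extend along monomorphisms with cokernel `W`. -/
theorem exists_extension (h : IsShortExactPair i p) {X : ModuleCat.{u} R} (hX : ExtVanishes W X 1)
    (f : A →ₗ[R] X) : ∃ g : B →ₗ[R] X, ∀ x, g (i x) = f x := by
  obtain ⟨x₂, hx₂⟩ := Ext.contravariant_sequence_exact₁ h.shortExact X
    (Ext.mk₀ (ModuleCat.ofHom f)) (add_zero 1) (hX.elim _ _)
  obtain ⟨g, rfl⟩ := (Ext.mk₀_bijective _ _).2 x₂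
  rw [Ext.mk₀_comp_mk₀] at hx₂
  have := (Ext.mk₀_bijective _ _).1 hx₂
  exact ⟨g.hom, fun x => congrArg (fun k : A ⟶ X => k.hom x) this⟩

theorem extVanishes_middle (h : IsShortExactPair i p) {X : ModuleCat.{u} R} {n : ℕ}
    (hA : ExtVanishes A X n) (hW : ExtVanishes W X n) : ExtVanishes B X n := by
  refine subsingleton_of_forall_eq 0 fun x => ?_
  obtain ⟨y, rfl⟩ := Ext.contravariant_sequence_exact₂ h.shortExact X x (hA.elim _ _)
  rw [hW.elim y 0, Ext.comp_zero]

theorem extVanishes_left (h : IsShortExactPair i p) {X : ModuleCat.{u} R} {n : ℕ}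
    (hB : ExtVanishes B X n) (hW : ExtVanishes W X (n + 1)) : ExtVanishes A X n := by
  refine subsingleton_of_forall_eq 0 fun x => ?_
  obtain ⟨y, rfl⟩ := Ext.contravariant_sequence_exact₁ h.shortExact X x (add_comm 1 n)
    (hW.elim _ _)
  rw [hB.elim y 0, Ext.comp_zero]

theorem extVanishes_right (h : IsShortExactPair i p) {X : ModuleCat.{u} R} {n : ℕ}
    (hB : ExtVanishes B X (n + 1)) (hA : ExtVanishes A X n) : ExtVanishes W X (n + 1) := by
  refine subsingleton_of_forall_eq 0 fun x => ?_
  obtain ⟨y, rfl⟩ := Ext.contravariant_sequence_exact₃ h.shortExact X x (hB.elim _ _)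
    (add_comm 1 n)
  rw [hA.elim y 0, Ext.comp_zero]

/-- Every class in $\mathrm{Ext}^1(W,X)$ is the connecting image of some $A\to X$, and that image is
zero when the map extends to `B`. -/
theorem extVanishes_one (h : IsShortExactPair i p) {X : ModuleCat.{u} R}
    (hB : ExtVanishes B X 1) (hX : ∀ f : A →ₗ[R] X, ∃ g : B →ₗ[R] X, ∀ x, g (i x) = f x) :
    ExtVanishes W X 1 := by
  refine subsingleton_of_forall_eq 0 fun x => ?_
  obtain ⟨y, rfl⟩ := Ext.contravariant_sequence_exact₃ h.shortExact X x (hB.elim _ _)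
    (add_zero 1)
  obtain ⟨f, rfl⟩ := (Ext.mk₀_bijective _ _).2 y
  obtain ⟨g, hg⟩ := hX f.hom
  have : f = h.shortComplex.f ≫ ModuleCat.ofHom g := by
    ext x; exact (hg x).symm
  rw [this, ← Ext.mk₀_comp_mk₀, h.shortExact.extClass_comp_assoc]

end

end IsShortExactPair

theorem extVanishes_of_projective (P X : ModuleCat.{u} R) [Module.Projective R P] (n : ℕ) :
    ExtVanishes P X (n + 1) := by
  have : CategoryTheory.Projective P := (IsProjective.iff_projective P).mp ‹_›
  exact Ext.subsingleton_of_projective P X n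

theorem ExtVanishes.of_retract_left {Y Z : ModuleCat.{u} R} (i : Z →ₗ[R] Y) (r : Y →ₗ[R] Z)
    (hr : ∀ x, r (i x) = x) {X : ModuleCat.{u} R} {n : ℕ} (h : ExtVanishes Y X n) :
    ExtVanishes Z X n := by
  refine subsingleton_of_forall_eq 0 fun x => ?_
  have e : ModuleCat.ofHom i ≫ ModuleCat.ofHom r = 𝟙 Z := by
    ext x; exact hr x
  rw [← Ext.mk₀_id_comp x, ← e, ← Ext.mk₀_comp_mk₀_assoc,
    h.elim ((Ext.mk₀ (ModuleCat.ofHom r)).comp x (zero_add n)) 0, Ext.comp_zero]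

theorem ExtVanishes.prod_right {X Y Z : ModuleCat.{u} R} {n : ℕ} (hY : ExtVanishes X Y n)
    (hZ : ExtVanishes X Z n) : ExtVanishes X (ModuleCat.of R (Y × Z)) n := by
  refine subsingleton_of_forall_eq 0 fun x => ?_
  have e : ModuleCat.ofHom (LinearMap.fst R Y Z) ≫ ModuleCat.ofHom (LinearMap.inl R Y Z) +
      ModuleCat.ofHom (LinearMap.snd R Y Z) ≫ ModuleCat.ofHom (LinearMap.inr R Y Z) =
      𝟙 (ModuleCat.of R (Y × Z)) := by
    ext x
    all_goals simp only [ModuleCat.hom_add, ModuleCat.hom_comp, ModuleCat.hom_id, ModuleCat.hom_ofHom,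
      LinearMap.comp_apply, LinearMap.add_apply]
    all_goals simp
  rw [← Ext.comp_mk₀_id x, ← e, Ext.mk₀_add, Ext.comp_add, ← Ext.mk₀_comp_mk₀,
    ← Ext.mk₀_comp_mk₀, ← Ext.comp_assoc_of_second_deg_zero, ← Ext.comp_assoc_of_second_deg_zero,
    hY.elim (x.comp (Ext.mk₀ (ModuleCat.ofHom (LinearMap.fst R Y Z))) (add_zero n)) 0,
    hZ.elim (x.comp (Ext.mk₀ (ModuleCat.ofHom (LinearMap.snd R Y Z))) (add_zero n)) 0,
    Ext.zero_comp, Ext.zero_comp, add_zero]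

/-- `Ext¹(W, X)` vanishes if all extensions of `W` by `X` split. -/
theorem extVanishes_one_of_split [IsNoetherianRing R] (W X : ModuleCat.{u} R) [Module.Finite R W]
    [Module.Finite R X]
    (H : ∀ (Y : ModuleCat.{u} R) (i : X →ₗ[R] Y) (p : Y →ₗ[R] W), Module.Finite R Y →
      IsShortExactPair i p → ∃ r : Y →ₗ[R] X, ∀ x, r (i x) = x) : ExtVanishes W X 1 := by
  obtain ⟨n, π, hπ⟩ := Module.Finite.exists_fin' R W
  have h := IsShortExactPair.of_surjective π hπ
  refine IsShortExactPair.extVanishes_one (A := ModuleCat.of R (LinearMap.ker π))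
    (B := ModuleCat.of R (Fin n → R)) h
    (have : Module.Projective R (ModuleCat.of R (Fin n → R)) :=
      inferInstanceAs (Module.Projective R (Fin n → R))
     extVanishes_of_projective _ _ 0) fun f => ?_
  -- The quotient by the range of `j` is the pushout of the kernel inclusion along `f`. A retraction
  -- of the resulting extension of `W` by `X`, restricted to the free module, extends `f`.
  let j : LinearMap.ker π →ₗ[R] X × (Fin n → R) := LinearMap.prod f (-(LinearMap.ker π).subtype)
  let N := LinearMap.range j
  let i : X →ₗ[R] (X × (Fin n → R)) ⧸ N := N.mkQ ∘ₗ LinearMap.inl R X (Fin n → R)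
  let p : ((X × (Fin n → R)) ⧸ N) →ₗ[R] W := N.liftQ (π ∘ₗ LinearMap.snd R X (Fin n → R)) (by
    rintro _ ⟨k, rfl⟩
    simp [j])
  have hse : IsShortExactPair i p := by
    refine ⟨?_, ?_, ?_⟩
    · rw [← LinearMap.ker_eq_bot, LinearMap.ker_eq_bot']
      intro x hx
      obtain ⟨k, hk⟩ := (Submodule.Quotient.mk_eq_zero N).mp hx
      have h1 : f k = x := congrArg Prod.fst hk
      have h2 : -(k : Fin n → R) = 0 := congrArg Prod.snd hk
      have : k = 0 := by ext1; simpa using h2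
      rw [← h1, this, map_zero]
    · intro y
      obtain ⟨⟨x, z⟩, rfl⟩ := N.mkQ_surjective y
      constructor
      · intro hz
        have hz : π z = 0 := hz
        refine ⟨x + f ⟨z, hz⟩, ?_⟩
        refine (Submodule.Quotient.eq N).mpr ⟨⟨z, hz⟩, ?_⟩
        ext <;> simp [j]
      · rintro ⟨x', hx'⟩
        rw [← hx']
        simp [i, p]
    · intro w
      obtain ⟨z, rfl⟩ := hπ w
      exact ⟨N.mkQ (0, z), by simp [p]⟩
  obtain ⟨r, hr⟩ := H (ModuleCat.of R _) i p
    (inferInstanceAs (Module.Finite R ((X × (Fin n → R)) ⧸ N))) hse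
  refine ⟨r ∘ₗ N.mkQ ∘ₗ LinearMap.inr R X (Fin n → R), fun k => ?_⟩
  have : N.mkQ (0, (k : Fin n → R)) = i (f k) := by
    refine (Submodule.Quotient.eq N).mpr ⟨-k, ?_⟩
    ext <;> simp [j]
  change r (N.mkQ (0, (k : Fin n → R))) = f k
  rw [this]
  exact hr _

end ExtCriteria

/-! ### Finitely presented functors form an abelian category -/

section FinitelyPresentedFunctors
set_option linter.unusedSectionVars false
open Opposite Limits
open scoped ZeroObject

variable {A : Type u} [Category.{v} A] [Preadditive A]

theorem map_op_add_apply (F : Aᵒᵖ ⥤ AddCommGrpCat.{v}) [F.Additive] {W X : A} (g h : W ⟶ X)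
    (x : F.obj (op X)) : F.map (g + h).op x = F.map g.op x + F.map h.op x := by
  rw [op_add, F.map_add]; rfl

theorem map_op_sub_apply (F : Aᵒᵖ ⥤ AddCommGrpCat.{v}) [F.Additive] {W X : A} (g h : W ⟶ X)
    (x : F.obj (op X)) : F.map (g - h).op x = F.map g.op x - F.map h.op x := by
  rw [eq_sub_iff_add_eq, ← map_op_add_apply, sub_add_cancel]

theorem map_op_zero_apply (F : Aᵒᵖ ⥤ AddCommGrpCat.{v}) [F.Additive] {W X : A}
    (x : F.obj (op X)) : F.map (0 : W ⟶ X).op x = 0 := by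
  rw [← sub_self (0 : W ⟶ X), map_op_sub_apply, sub_self]

theorem map_op_comp_apply (F : Aᵒᵖ ⥤ AddCommGrpCat.{v}) {V W X : A} (g : V ⟶ W) (h : W ⟶ X)
    (x : F.obj (op X)) : F.map (g ≫ h).op x = F.map g.op (F.map h.op x) := by
  rw [op_comp, F.map_comp]; rfl

/-- The morphism from a representable functor determined by an element. -/
def yonedaElement (F : Aᵒᵖ ⥤ AddCommGrpCat.{v}) [F.Additive] {X : A} (x : F.obj (op X)) :
    preadditiveYoneda.obj X ⟶ F where
  app W := AddCommGrpCat.ofHom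
    { toFun := fun g : W.unop ⟶ X => F.map g.op x
      map_zero' := map_op_zero_apply F x
      map_add' := fun g h => map_op_add_apply F (W := W.unop) g h x }
  naturality W V k := by
    ext g
    exact map_op_comp_apply F k.unop (show W.unop ⟶ X from g) x

theorem app_eq_map_apply {F : Aᵒᵖ ⥤ AddCommGrpCat.{v}} {X : A} (p : preadditiveYoneda.obj X ⟶ F)
    {W : A} (g : W ⟶ X) : p.app (op W) g = F.map g.op (p.app (op X) (𝟙 X)) := by
  have := NatTrans.naturality_apply p g.op (𝟙 X)
  rw [← this]
  congr 1
  exact (Category.comp_id g).symm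

theorem preadditiveYoneda_map_app {X Y W : A} (f : X ⟶ Y) (g : W ⟶ X) :
    (preadditiveYoneda.map f).app (op W) g = g ≫ f := rfl

/-- `F` is generated by `x`, with relations generated by `f`. -/
structure IsPresentedBy (F : Aᵒᵖ ⥤ AddCommGrpCat.{v}) {X₁ X₀ : A} (f : X₁ ⟶ X₀)
    (x : F.obj (op X₀)) : Prop where
  additive : F.Additive
  generates : ∀ (W : A) (y : F.obj (op W)), ∃ g : W ⟶ X₀, F.map g.op x = y
  relation : F.map f.op x = 0
  exists_of_map_eq_zero : ∀ (W : A) (g : W ⟶ X₀), F.map g.op x = 0 → ∃ h : W ⟶ X₁, h ≫ f = g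

theorem isFinitelyPresented_iff (F : Aᵒᵖ ⥤ AddCommGrpCat.{v}) :
    IsFinitelyPresented A F ↔ ∃ (X₁ X₀ : A) (f : X₁ ⟶ X₀) (x : F.obj (op X₀)),
      IsPresentedBy F f x := by
  constructor
  · rintro ⟨hF, X₁, X₀, f, p, h⟩
    obtain ⟨f, rfl⟩ := preadditiveYoneda.map_surjective f
    have key : ∀ W (g : W ⟶ X₀), F.map g.op (p.app (op X₀) (𝟙 X₀)) = 0 ↔
        ∃ k : W ⟶ X₁, k ≫ f = g := fun W g => by
      rw [← app_eq_map_apply]; exact (h (op W)).1 g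
    refine ⟨X₁, X₀, f, p.app (op X₀) (𝟙 X₀), hF, fun W y => ?_, ?_, fun W g => (key W g).1⟩
    · obtain ⟨g, hg⟩ := (h (op W)).2 y
      exact ⟨g, (app_eq_map_apply p g).symm.trans hg⟩
    · exact (key _ _).2 ⟨𝟙 _, Category.id_comp _⟩
  · rintro ⟨X₁, X₀, f, x, hx⟩
    have := hx.additive
    refine ⟨hx.additive, X₁, X₀, preadditiveYoneda.map f, yonedaElement F x, fun W => ⟨?_, ?_⟩⟩
    · intro g
      constructor
      · exact fun hg => hx.exists_of_map_eq_zero W.unop g hg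
      · rintro ⟨k : W.unop ⟶ X₁, rfl⟩
        change F.map (k ≫ f).op x = 0
        rw [op_comp, F.map_comp, ConcreteCategory.comp_apply, hx.relation, map_zero]
    · exact fun y => hx.generates W.unop y

theorem isPresentedBy_yoneda [HasZeroObject A] (X : A) :
    IsPresentedBy (preadditiveYoneda.obj X) (0 : (0 : A) ⟶ X) (𝟙 X) where
  additive := inferInstance
  generates W y := ⟨y, Category.comp_id _⟩
  relation := Category.comp_id _
  exists_of_map_eq_zero W g h := ⟨0, by
    have : g ≫ 𝟙 X = 0 := h
    rw [Category.comp_id] at this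
    rw [this, comp_zero]⟩

theorem isFinitelyPresented_yoneda [HasZeroObject A] (X : A) :
    IsFinitelyPresented A (preadditiveYoneda.obj X) :=
  (isFinitelyPresented_iff _).mpr ⟨_, _, _, _, isPresentedBy_yoneda X⟩

/-- Weak kernels exist in `A`. -/
def WeakKernelsExist (A : Type u) [Category.{v} A] [Preadditive A] : Prop :=
  ∀ ⦃X Y : A⦄ (f : X ⟶ Y), ∃ (Z : A) (k : Z ⟶ X), k ≫ f = 0 ∧
    ∀ (W : A) (g : W ⟶ X), g ≫ f = 0 → ∃ h : W ⟶ Z, h ≫ k = g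

theorem shortComplex_app_exact {S : ShortComplex (Aᵒᵖ ⥤ AddCommGrpCat.{v})} (hS : S.Exact)
    (W : Aᵒᵖ) : Function.Exact (S.f.app W) (S.g.app W) :=
  (ShortComplex.ab_exact_iff_function_exact _).mp (hS.map ((evaluation _ _).obj W))

theorem cokernelCofork_app {F G : Aᵒᵖ ⥤ AddCommGrpCat.{v}} {φ : F ⟶ G} {k : CokernelCofork φ}
    (hk : IsColimit k) (W : Aᵒᵖ) : Function.Exact (φ.app W) (k.π.app W) ∧
      Function.Surjective (k.π.app W) := by
  refine ⟨shortComplex_app_exact (S := ShortComplex.mk φ k.π k.condition)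
    (ShortComplex.exact_of_g_is_cokernel _
      (IsColimit.ofIsoColimit hk (Cofork.ext (Iso.refl _)))) W, ?_⟩
  have : Epi k.π := Cofork.IsColimit.epi hk
  have := (NatTrans.epi_iff_epi_app k.π).mp this W
  exact (AddCommGrpCat.epi_iff_surjective _).mp this

theorem kernelFork_app {F G : Aᵒᵖ ⥤ AddCommGrpCat.{v}} {φ : F ⟶ G} {k : KernelFork φ}
    (hk : IsLimit k) (W : Aᵒᵖ) : Function.Exact (k.ι.app W) (φ.app W) ∧
      Function.Injective (k.ι.app W) := by
  refine ⟨shortComplex_app_exact (S := ShortComplex.mk k.ι φ k.condition)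
    (ShortComplex.exact_of_f_is_kernel _
      (IsLimit.ofIsoLimit hk (Fork.ext (Iso.refl _)))) W, ?_⟩
  have : Mono k.ι := Fork.IsLimit.mono hk
  have := (NatTrans.mono_iff_mono_app k.ι).mp this W
  exact (AddCommGrpCat.mono_iff_injective _).mp this

theorem additive_of_surjective {F G : Aᵒᵖ ⥤ AddCommGrpCat.{v}} [F.Additive] (π : F ⟶ G)
    (hπ : ∀ W, Function.Surjective (π.app W)) : G.Additive where
  map_add {X Y f g} := by
    ext y
    obtain ⟨x, rfl⟩ := hπ _ y
    rw [AddCommGrpCat.hom_add_apply]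
    have h := fun f => NatTrans.naturality_apply π (X := X) (Y := Y) f x
    change G.map (f + g) (π.app X x) = G.map f (π.app X x) + G.map g (π.app X x)
    rw [← h, ← h, ← h, F.map_add, ← map_add]
    rfl

theorem additive_of_injective {F G : Aᵒᵖ ⥤ AddCommGrpCat.{v}} [G.Additive] (ι : F ⟶ G)
    (hι : ∀ W, Function.Injective (ι.app W)) : F.Additive where
  map_add {X Y f g} := by
    ext x
    apply hι
    change ι.app Y (F.map (f + g) x) = ι.app Y (F.map f x + F.map g x)
    rw [map_add, NatTrans.naturality_apply, NatTrans.naturality_apply, NatTrans.naturality_apply,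
      G.map_add]
    rfl

/-- Lift the map to the generators as $a:X_0\to Y_0$; the relations of the cokernel are those of the
target together with $a$. -/
theorem isClosedUnderCokernels_isFinitelyPresented [HasBinaryBiproducts A] :
    (IsFinitelyPresented A).IsClosedUnderCokernels where
  cokernels_le := by
    intro K hK
    obtain @⟨F, G, φ, k, hk, ⟨hF, hG⟩⟩ := hK
    obtain ⟨X₁, X₀, f, x, hx⟩ := (isFinitelyPresented_iff _).mp hF
    obtain ⟨Y₁, Y₀, g, y, hy⟩ := (isFinitelyPresented_iff _).mp hG
    have hk' := cokernelCofork_app hk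
    have := hF.1
    have := hG.1
    obtain ⟨a, ha⟩ := hy.generates _ (φ.app _ x)
    refine (isFinitelyPresented_iff _).mpr ⟨Y₁ ⊞ X₀, Y₀, biprod.desc g a, k.π.app _ y,
      additive_of_surjective k.π fun W => (hk' W).2, ?_, ?_, ?_⟩
    · intro W z
      obtain ⟨z, rfl⟩ := (hk' _).2 z
      obtain ⟨b, rfl⟩ := hy.generates _ z
      exact ⟨b, (NatTrans.naturality_apply k.π b.op y).symm⟩
    · rw [← NatTrans.naturality_apply]
      refine ((hk' _).1 _).mpr ⟨F.map (biprod.snd : Y₁ ⊞ X₀ ⟶ X₀).op x, ?_⟩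
      rw [NatTrans.naturality_apply, ← ha, biprod.desc_eq, map_op_add_apply, map_op_comp_apply,
        map_op_comp_apply, hy.relation, map_zero, zero_add]
    · intro W b hb
      rw [← NatTrans.naturality_apply] at hb
      obtain ⟨z, hz⟩ := ((hk' _).1 _).mp hb
      obtain ⟨c, rfl⟩ := hx.generates _ z
      rw [NatTrans.naturality_apply, ← ha, ← map_op_comp_apply, eq_comm, ← sub_eq_zero,
        ← map_op_sub_apply] at hz
      obtain ⟨d, hd⟩ := hy.exists_of_map_eq_zero _ _ hz
      exact ⟨biprod.lift d c, by rw [biprod.lift_desc, hd, sub_add_cancel]⟩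

/-- One weak kernel supplies generators of the kernel and a second one supplies their relations,
much as finitely presented modules over a coherent ring have finitely presented kernels. -/
theorem isClosedUnderKernels_isFinitelyPresented [HasBinaryBiproducts A]
    (hA : WeakKernelsExist A) : (IsFinitelyPresented A).IsClosedUnderKernels where
  kernels_le := by
    intro K hK
    obtain @⟨F, G, φ, k, hk, ⟨hF, hG⟩⟩ := hK
    obtain ⟨X₁, X₀, f, x, hx⟩ := (isFinitelyPresented_iff _).mp hF
    obtain ⟨Y₁, Y₀, g, y, hy⟩ := (isFinitelyPresented_iff _).mp hG
    have hk' := kernelFork_app hk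
    have := hF.1
    have := hG.1
    obtain ⟨a, ha⟩ := hy.generates _ (φ.app _ x)
    have hker : ∀ (W : A) (b : W ⟶ X₀), φ.app _ (F.map b.op x) = 0 ↔
        ∃ c : W ⟶ Y₁, c ≫ g = b ≫ a := by
      intro W b
      rw [NatTrans.naturality_apply, ← ha, ← map_op_comp_apply]
      constructor
      · exact fun h => hy.exists_of_map_eq_zero _ _ h
      · rintro ⟨c, hc⟩
        rw [← hc, map_op_comp_apply, hy.relation, map_zero]
    -- `Z` collects pairs of a generator of the source and a relation of the target with the same
    -- image in $Y_0$; `V` then detects which of these generators are zero in the source.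
    obtain ⟨Z, z, hz, hz'⟩ := hA (biprod.desc a (-g) : X₀ ⊞ Y₁ ⟶ Y₀)
    obtain ⟨V, v, hv, hv'⟩ := hA (biprod.desc (z ≫ biprod.fst) (-f) : Z ⊞ X₁ ⟶ X₀)
    have hz0 : ∃ c : Z ⟶ Y₁, c ≫ g = (z ≫ biprod.fst) ≫ a := by
      refine ⟨z ≫ biprod.snd, ?_⟩
      rw [biprod.desc_eq, Preadditive.comp_add, Preadditive.comp_neg, Preadditive.comp_neg,
        add_neg_eq_zero] at hz
      simpa using hz.symm
    obtain ⟨t, ht⟩ := ((hk' _).1 _).mp ((hker _ _).mpr hz0)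
    have hmap : ∀ (W : A) (b : W ⟶ Z), k.ι.app _ (k.pt.map b.op t) =
        F.map (b ≫ z ≫ biprod.fst).op x := by
      intro W b
      rw [NatTrans.naturality_apply, ht, ← map_op_comp_apply]
    refine (isFinitelyPresented_iff _).mpr ⟨V, Z, v ≫ biprod.fst, t,
      additive_of_injective k.ι fun W => (hk' W).2, ?_, ?_, ?_⟩
    · intro W s
      obtain ⟨b, hb⟩ := hx.generates _ (k.ι.app _ s)
      obtain ⟨c, hc⟩ := (hker _ b).mp (by rw [hb]; exact (hk' _).1.apply_apply_eq_zero s)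
      obtain ⟨d, hd⟩ := hz' W (biprod.lift b c) (by rw [biprod.lift_desc]; simp [hc])
      refine ⟨d, (hk' _).2 ?_⟩
      rw [hmap, ← hb, ← Category.assoc, hd, biprod.lift_fst]
    · apply (hk' _).2
      rw [hmap, map_zero]
      have : (v ≫ biprod.fst) ≫ z ≫ biprod.fst = (v ≫ biprod.snd) ≫ f := by
        rw [biprod.desc_eq, Preadditive.comp_add, Preadditive.comp_neg, Preadditive.comp_neg,
          add_neg_eq_zero] at hv
        simpa using hv
      rw [this, map_op_comp_apply, hx.relation, map_zero]
    · intro W b hb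
      have := congrArg (k.ι.app _) hb
      rw [hmap, map_zero] at this
      obtain ⟨c, hc⟩ := hx.exists_of_map_eq_zero _ _ this
      obtain ⟨d, hd⟩ := hv' W (biprod.lift b c) (by rw [biprod.lift_desc]; simp [hc])
      exact ⟨d, by rw [← Category.assoc, hd, biprod.lift_fst]⟩

theorem isFinitelyPresented_zero [HasZeroObject A] {F : Aᵒᵖ ⥤ AddCommGrpCat.{v}} (hF : IsZero F) :
    IsFinitelyPresented A F := by
  have hs : ∀ W, Subsingleton (F.obj W) := fun W =>
    AddCommGrpCat.subsingleton_of_isZero ((Functor.isZero_iff F).mp hF W)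
  refine (isFinitelyPresented_iff _).mpr ⟨0, 0, 0, 0, ⟨?_⟩, fun W y => ⟨0, (hs _).elim _ _⟩,
    (hs _).elim _ _, fun W g _ => ⟨g, (isZero_zero A).eq_of_tgt _ _⟩⟩
  intro X Y f g
  ext x
  exact (hs _).elim _ _

theorem isFinitelyPresented_prod [HasBinaryBiproducts A] {F G H : Aᵒᵖ ⥤ AddCommGrpCat.{v}}
    (hF : IsFinitelyPresented A F) (hG : IsFinitelyPresented A G) (i : F ⟶ H) (j : G ⟶ H)
    (p : H ⟶ F) (q : H ⟶ G) (hip : i ≫ p = 𝟙 F) (hjq : j ≫ q = 𝟙 G) (hiq : i ≫ q = 0)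
    (hjp : j ≫ p = 0) (hpq : p ≫ i + q ≫ j = 𝟙 H) : IsFinitelyPresented A H := by
  obtain ⟨X₁, X₀, f, x, hx⟩ := (isFinitelyPresented_iff _).mp hF
  obtain ⟨Y₁, Y₀, g, y, hy⟩ := (isFinitelyPresented_iff _).mp hG
  have := hF.1
  have := hG.1
  have eip : ∀ W (a : F.obj W), p.app W (i.app W a) = a := fun W a =>
    ConcreteCategory.congr_hom (NatTrans.congr_app hip W) a
  have ejq : ∀ W (a : G.obj W), q.app W (j.app W a) = a := fun W a =>
    ConcreteCategory.congr_hom (NatTrans.congr_app hjq W) a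
  have eiq : ∀ W (a : F.obj W), q.app W (i.app W a) = 0 := fun W a =>
    ConcreteCategory.congr_hom (NatTrans.congr_app hiq W) a
  have ejp : ∀ W (a : G.obj W), p.app W (j.app W a) = 0 := fun W a =>
    ConcreteCategory.congr_hom (NatTrans.congr_app hjp W) a
  have epq : ∀ W (a : H.obj W), i.app W (p.app W a) + j.app W (q.app W a) = a := fun W a =>
    ConcreteCategory.congr_hom (NatTrans.congr_app hpq W) a
  have hext : ∀ W (a b : H.obj W), p.app W a = p.app W b → q.app W a = q.app W b → a = b := by
    intro W a b h1 h2
    rw [← epq W a, ← epq W b, h1, h2]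
  have hadd : H.Additive := by
    refine ⟨fun {X Y f g} => ?_⟩
    ext a
    change H.map (f + g) a = H.map f a + H.map g a
    apply hext <;> rw [map_add, NatTrans.naturality_apply, NatTrans.naturality_apply,
      NatTrans.naturality_apply, Functor.map_add] <;> rfl
  let hh := i.app _ (F.map (biprod.fst : X₀ ⊞ Y₀ ⟶ X₀).op x) +
    j.app _ (G.map (biprod.snd : X₀ ⊞ Y₀ ⟶ Y₀).op y)
  have hhp : ∀ W (a : W ⟶ X₀ ⊞ Y₀), p.app _ (H.map a.op hh) = F.map (a ≫ biprod.fst).op x := by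
    intro W a
    rw [NatTrans.naturality_apply, map_add, eip, ejp, add_zero, map_op_comp_apply]
  have hhq : ∀ W (a : W ⟶ X₀ ⊞ Y₀), q.app _ (H.map a.op hh) = G.map (a ≫ biprod.snd).op y := by
    intro W a
    rw [NatTrans.naturality_apply, map_add, ejq, eiq, zero_add, map_op_comp_apply]
  refine (isFinitelyPresented_iff _).mpr ⟨X₁ ⊞ Y₁, X₀ ⊞ Y₀, biprod.map f g, hh, hadd, ?_, ?_, ?_⟩
  · intro W z
    obtain ⟨a, ha⟩ := hx.generates _ (p.app _ z)
    obtain ⟨b, hb⟩ := hy.generates _ (q.app _ z)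
    refine ⟨biprod.lift a b, hext _ _ _ ?_ ?_⟩
    · rw [hhp, biprod.lift_fst, ha]
    · rw [hhq, biprod.lift_snd, hb]
  · apply hext
    · rw [hhp, map_zero, biprod.map_fst, map_op_comp_apply,
        hx.relation, map_zero]
    · rw [hhq, map_zero, biprod.map_snd, map_op_comp_apply,
        hy.relation, map_zero]
  · intro W a ha
    obtain ⟨b, hb⟩ := hx.exists_of_map_eq_zero _ (a ≫ biprod.fst) (by rw [← hhp, ha, map_zero])
    obtain ⟨c, hc⟩ := hy.exists_of_map_eq_zero _ (a ≫ biprod.snd) (by rw [← hhq, ha, map_zero])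
    refine ⟨biprod.lift b c, ?_⟩
    ext <;> simp [hb, hc]

theorem containsZero_isFinitelyPresented [HasZeroObject A] :
    (IsFinitelyPresented A).ContainsZero where
  exists_zero := ⟨0, isZero_zero _, isFinitelyPresented_zero (isZero_zero _)⟩

theorem isClosedUnderFiniteProducts_isFinitelyPresented [HasZeroObject A]
    [HasBinaryBiproducts A] (hA : WeakKernelsExist A) :
    (IsFinitelyPresented A).IsClosedUnderFiniteProducts := by
  have := containsZero_isFinitelyPresented (A := A)
  have : (IsFinitelyPresented A).IsClosedUnderIsomorphisms := by
    have := isClosedUnderKernels_isFinitelyPresented hA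
    refine ⟨fun {X Y} e hX => ?_⟩
    exact (IsFinitelyPresented A).prop_of_isLimit_kernelFork
      (k := KernelFork.ofι (f := (0 : X ⟶ X)) e.inv (by simp))
      (KernelFork.IsLimit.ofι _ _ (fun g _ => g ≫ e.hom) (by simp) (by
        intro W g _ m hm; simp [← hm])) hX hX
  have : (IsFinitelyPresented A).IsClosedUnderBinaryProducts := by
    refine ⟨?_⟩
    rintro X ⟨h⟩
    have hF := h.prop_diag_obj ⟨WalkingPair.left⟩
    have hG := h.prop_diag_obj ⟨WalkingPair.right⟩
    have e : (h.diag.obj ⟨WalkingPair.left⟩) ⨯ (h.diag.obj ⟨WalkingPair.right⟩) ≅ X := by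
      refine IsLimit.conePointUniqueUpToIso
        (limit.isLimit _) ((IsLimit.postcomposeHomEquiv (diagramIsoPair h.diag) _).symm h.isLimit)
    refine (IsFinitelyPresented A).prop_of_iso ((biprod.isoProd _ _).trans e) ?_
    exact isFinitelyPresented_prod hF hG biprod.inl biprod.inr biprod.fst biprod.snd (by simp)
      (by simp) (by simp) (by simp) biprod.total
  exact ObjectProperty.IsClosedUnderFiniteProducts.mk'

/-- Finitely presented functors on a category with weak kernels form an abelian category. -/
theorem nonempty_abelian_finPresFunctors [HasZeroObject A] [HasBinaryBiproducts A]
    (hA : WeakKernelsExist A) : Nonempty (Abelian (FinPresFunctors A)) := by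
  have := containsZero_isFinitelyPresented (A := A)
  have := isClosedUnderKernels_isFinitelyPresented hA
  have := isClosedUnderCokernels_isFinitelyPresented (A := A)
  have := isClosedUnderFiniteProducts_isFinitelyPresented hA
  exact ⟨inferInstance⟩

end FinitelyPresentedFunctors

/-! ### Representables as projective and injective objects -/

section FinPresFrobenius
set_option linter.unusedSectionVars false
open Opposite Limits
open scoped ZeroObject

variable {A : Type u} [Category.{v} A] [Preadditive A] [HasZeroObject A] [HasBinaryBiproducts A]

/-- The representable functors as finitely presented functors. -/
abbrev finPresYoneda (X : A) : FinPresFunctors A :=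
  ⟨preadditiveYoneda.obj X, isFinitelyPresented_yoneda X⟩

/-- Representables are finitely presented, so an element killed by $\varphi$ is a test morphism
within the category. -/
theorem app_injective_of_mono {F G : FinPresFunctors A} (φ : F ⟶ G) [Mono φ] (W : Aᵒᵖ) :
    Function.Injective (φ.hom.app W) := by
  have := F.property.1
  rw [injective_iff_map_eq_zero]
  intro x hx
  let t : finPresYoneda W.unop ⟶ F :=
    ObjectProperty.homMk (yonedaElement F.obj (X := W.unop) x)
  have ht : t ≫ φ = 0 := by
    ext V g
    change φ.hom.app V (F.obj.map (Quiver.Hom.op (show V.unop ⟶ W.unop from g)) x) = 0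
    rw [NatTrans.naturality_apply]
    erw [hx, map_zero]
  have h0 : t = 0 := by rw [← cancel_mono φ, ht, zero_comp]
  have := congrArg (fun s : finPresYoneda W.unop ⟶ F => s.hom.app W (𝟙 W.unop)) h0
  have h1 : F.obj.map (𝟙 W.unop).op x = 0 := this
  rw [op_id, F.obj.map_id] at h1
  exact h1

theorem mono_of_app_injective {F G : FinPresFunctors A} (φ : F ⟶ G)
    (h : ∀ W, Function.Injective (φ.hom.app W)) : Mono φ := by
  have : Mono φ.hom := by
    rw [NatTrans.mono_iff_mono_app]
    exact fun W => (AddCommGrpCat.mono_iff_injective _).mpr (h W)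
  exact (IsFinitelyPresented A).ι.mono_of_mono_map this

theorem epi_of_app_surjective {F G : FinPresFunctors A} (φ : F ⟶ G)
    (h : ∀ W, Function.Surjective (φ.hom.app W)) : Epi φ := by
  have : Epi φ.hom := by
    rw [NatTrans.epi_iff_epi_app]
    exact fun W => (AddCommGrpCat.epi_iff_surjective _).mpr (h W)
  exact (IsFinitelyPresented A).ι.epi_of_epi_map this

/-- The pointwise cokernel is again finitely presented, so it is a legitimate test object and its
projection must be zero. -/
theorem app_surjective_of_epi {F G : FinPresFunctors A} (φ : F ⟶ G) [Epi φ] (W : Aᵒᵖ) :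
    Function.Surjective (φ.hom.app W) := by
  have := isClosedUnderCokernels_isFinitelyPresented (A := A)
  let Q : FinPresFunctors A := ⟨cokernel φ.hom,
    (IsFinitelyPresented A).prop_cokernel φ.hom F.property G.property⟩
  let π : G ⟶ Q := ObjectProperty.homMk (cokernel.π φ.hom)
  have h0 : π = 0 := by
    rw [← cancel_epi φ, comp_zero]
    ext1
    exact cokernel.condition φ.hom
  intro y
  have he := (cokernelCofork_app (cokernelIsCokernel φ.hom) W).1
  exact (he y).mp (congrArg (fun s : G ⟶ Q => s.hom.app W y) h0)

theorem projective_finPresYoneda (X : A) : Projective (finPresYoneda X) where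
  factors {E G} f e _ := by
    have := E.property.1
    obtain ⟨x, hx⟩ := app_surjective_of_epi e (op X) (f.hom.app (op X) (𝟙 X))
    refine ⟨ObjectProperty.homMk (yonedaElement E.obj x), ?_⟩
    ext W g
    change e.hom.app W (E.obj.map (Quiver.Hom.op (show W.unop ⟶ X from g)) x) = _
    rw [NatTrans.naturality_apply]
    erw [hx]
    exact (app_eq_map_apply f.hom (W := W.unop) g).symm

theorem exists_epi_finPresYoneda (F : FinPresFunctors A) :
    ∃ (X : A) (π : finPresYoneda X ⟶ F), Epi π := by
  obtain ⟨_, X, f, x, hx⟩ := (isFinitelyPresented_iff _).mp F.property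
  have := F.property.1
  exact ⟨X, ObjectProperty.homMk (yonedaElement F.obj x),
    epi_of_app_surjective _ fun W => hx.generates W.unop⟩

theorem enoughProjectives_finPresFunctors : EnoughProjectives (FinPresFunctors A) where
  presentation F := by
    obtain ⟨X, π, hπ⟩ := exists_epi_finPresYoneda F
    exact ⟨{ p := finPresYoneda X, projective := projective_finPresYoneda X, f := π, epi := hπ }⟩

/-- If representables are injective, stable monomorphisms split. -/
theorem IsFrobeniusCategory.exists_retraction (h : IsFrobeniusCategory (FinPresFunctors A))
    {Y X : A} (p : Y ⟶ X) (hp : ∀ (U : A) (g : U ⟶ Y), g ≫ p = 0 → g = 0) :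
    ∃ q : X ⟶ Y, p ≫ q = 𝟙 Y := by
  have := h.injective_of_projective _ (projective_finPresYoneda Y)
  let φ : finPresYoneda Y ⟶ finPresYoneda X := ObjectProperty.homMk (preadditiveYoneda.map p)
  have : Mono φ := mono_of_app_injective φ fun W => by
    rw [injective_iff_map_eq_zero]
    exact fun g hg => hp _ g hg
  obtain ⟨ψ, hψ⟩ := Injective.factors (𝟙 (finPresYoneda Y)) φ
  obtain ⟨q, hq⟩ := preadditiveYoneda.map_surjective ψ.hom
  refine ⟨q, preadditiveYoneda.map_injective ?_⟩
  rw [Functor.map_comp, hq, CategoryTheory.Functor.map_id]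
  exact congrArg (fun s => s.hom) hψ

/-- If injectives are projective and there are enough injectives, finitely presented functors embed
in representable ones. -/
theorem IsFrobeniusCategory.exists_embedding (h : IsFrobeniusCategory (FinPresFunctors A))
    (F : Aᵒᵖ ⥤ AddCommGrpCat.{v}) (hF : IsFinitelyPresented A F) :
    ∃ (V : A) (φ : F ⟶ preadditiveYoneda.obj V), ∀ W, Function.Injective (φ.app W) := by
  have := h.enoughInjectives
  obtain ⟨⟨J, hJ, ι, hι⟩⟩ := EnoughInjectives.presentation (⟨F, hF⟩ : FinPresFunctors A)
  have hP := h.projective_of_injective J hJ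
  obtain ⟨V, π, hπ⟩ := exists_epi_finPresYoneda J
  let s := Projective.factorThru (𝟙 J) π
  have hs : s ≫ π = 𝟙 J := Projective.factorThru_comp _ _
  have : Mono s := mono_of_mono_fac hs
  exact ⟨V, (ι ≫ s).hom, fun W => app_injective_of_mono (ι ≫ s) W⟩

/-- Once representables are shown to be injective, `h₂` gives enough injectives, and both the
projectives and the injectives are exactly the summands of representables. -/
theorem isFrobeniusCategory_finPresFunctors (hA : WeakKernelsExist A)
    (h₁ : ∀ (Y X : A) (p : Y ⟶ X), (∀ (U : A) (g : U ⟶ Y), g ≫ p = 0 → g = 0) →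
      ∃ q : X ⟶ Y, p ≫ q = 𝟙 Y)
    (h₂ : ∀ (F : Aᵒᵖ ⥤ AddCommGrpCat.{v}), IsFinitelyPresented A F →
      ∃ (V : A) (φ : F ⟶ preadditiveYoneda.obj V), ∀ W, Function.Injective (φ.app W)) :
    IsFrobeniusCategory (FinPresFunctors A) := by
  obtain ⟨hab⟩ := nonempty_abelian_finPresFunctors hA
  have hemb : ∀ F : FinPresFunctors A, ∃ (V : A) (φ : F ⟶ finPresYoneda V), Mono φ := fun F => by
    obtain ⟨V, φ, hφ⟩ := h₂ F.obj F.property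
    exact ⟨V, ObjectProperty.homMk φ, mono_of_app_injective _ hφ⟩
  have hinj : ∀ X : A, Injective (finPresYoneda X) := fun X => by
    refine ⟨fun {F G} t ι hι => ?_⟩
    -- To extend `t` along `ι`, push out and embed the pushout in a representable. The composite
    -- from the representable of `X` is monic between representables, hence split by `h₁`.
    obtain ⟨V, φ, hφ⟩ := hemb (pushout ι t)
    obtain ⟨p, hp⟩ := preadditiveYoneda.map_surjective (pushout.inr ι t ≫ φ).hom
    have hm : Mono (pushout.inr ι t ≫ φ) := mono_comp _ _
    obtain ⟨q, hq⟩ := h₁ X V p (fun U g hg => by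
      have hi := app_injective_of_mono (pushout.inr ι t ≫ φ) (op U)
      refine hi (Eq.trans ?_ (map_zero _).symm)
      rw [← hp]
      exact hg)
    have hs : (pushout.inr ι t ≫ φ) ≫ ObjectProperty.homMk (preadditiveYoneda.map q) =
        𝟙 (finPresYoneda X) := by
      ext1
      change (pushout.inr ι t ≫ φ).hom ≫ preadditiveYoneda.map q = _
      rw [← hp, ← Functor.map_comp, hq, CategoryTheory.Functor.map_id]
      rfl
    refine ⟨pushout.inl ι t ≫ φ ≫ ObjectProperty.homMk (preadditiveYoneda.map q), ?_⟩
    rw [← Category.assoc, pushout.condition, Category.assoc, ← Category.assoc _ φ, hs,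
      Category.comp_id]
  refine ⟨⟨hab⟩, enoughProjectives_finPresFunctors, ⟨fun F => ?_⟩, fun F hF => ?_, fun F hF => ?_⟩
  · obtain ⟨V, φ, hφ⟩ := hemb F
    exact ⟨⟨finPresYoneda V, hinj V, φ, hφ⟩⟩
  · obtain ⟨X, π, hπ⟩ := exists_epi_finPresYoneda F
    have hs := Projective.factorThru_comp (𝟙 F) π
    have := hinj X
    exact (Retract.mk _ π hs).injective
  · obtain ⟨V, φ, hφ⟩ := hemb F
    have hs := Injective.comp_factorThru (𝟙 F) φ
    have := projective_finPresYoneda V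
    exact (Retract.mk φ _ hs).projective

end FinPresFrobenius

/-! ### Embeddings in representables as a property of maps -/

section FinPresFrobenius
set_option linter.unusedSectionVars false
open Opposite Limits
open scoped ZeroObject

variable {A : Type u} [Category.{v} A] [Preadditive A] [HasZeroObject A] [HasBinaryBiproducts A]

/-- The cokernel of the map of representables induced by `f` embeds in some $\mathrm{Hom}(-,V)$, and
Yoneda turns this embedding into `v`. The property obtained is that `f` is a weak kernel of `v`. -/
theorem IsFrobeniusCategory.exists_weakCokernel (h : IsFrobeniusCategory (FinPresFunctors A))
    {X₁ X₀ : A} (f : X₁ ⟶ X₀) : ∃ (V : A) (v : X₀ ⟶ V), ∀ (U : A) (g : U ⟶ X₀),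
      g ≫ v = 0 ↔ ∃ k : U ⟶ X₁, k ≫ f = g := by
  have hc := cokernelCofork_app (cokernelIsCokernel (preadditiveYoneda.map f))
  have hF : IsFinitelyPresented A (cokernel (preadditiveYoneda.map f)) :=
    ⟨additive_of_surjective (cokernel.π (preadditiveYoneda.map f)) fun W => (hc W).2,
      X₁, X₀, preadditiveYoneda.map f, cokernel.π _, hc⟩
  obtain ⟨V, φ, hφ⟩ := h.exists_embedding _ hF
  obtain ⟨v, hv⟩ := preadditiveYoneda.map_surjective (cokernel.π (preadditiveYoneda.map f) ≫ φ)
  refine ⟨V, v, fun U g => ?_⟩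
  have h1 : g ≫ v = φ.app (op U) ((cokernel.π (preadditiveYoneda.map f)).app (op U) g) := by
    rw [← preadditiveYoneda_map_app v g, hv]
    rfl
  rw [h1]
  refine Iff.trans ?_ ((hc (op U)).1 g)
  constructor
  · exact fun hg => hφ _ (hg.trans (map_zero _).symm)
  · intro hg
    erw [hg]
    exact map_zero _

/-- The elements of `F` are classes of maps to $X_0$ modulo those through `f`; composition with `v`
is well defined and injective on these classes. -/
theorem exists_embedding_of_weakCokernel
    (h : ∀ (X₁ X₀ : A) (f : X₁ ⟶ X₀), ∃ (V : A) (v : X₀ ⟶ V), ∀ (U : A) (g : U ⟶ X₀),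
      g ≫ v = 0 ↔ ∃ k : U ⟶ X₁, k ≫ f = g)
    (F : Aᵒᵖ ⥤ AddCommGrpCat.{v}) (hF : IsFinitelyPresented A F) :
    ∃ (V : A) (φ : F ⟶ preadditiveYoneda.obj V), ∀ W, Function.Injective (φ.app W) := by
  obtain ⟨X₁, X₀, f, x, hx⟩ := (isFinitelyPresented_iff _).mp hF
  have := hF.1
  obtain ⟨V, v, hv⟩ := h X₁ X₀ f
  have hz : ∀ (W : A) (g : W ⟶ X₀), F.map g.op x = 0 ↔ g ≫ v = 0 := fun W g => by
    rw [hv]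
    constructor
    · exact hx.exists_of_map_eq_zero W g
    · rintro ⟨k, rfl⟩
      rw [map_op_comp_apply, hx.relation, map_zero]
  have heq : ∀ (W : A) (g g' : W ⟶ X₀), F.map g.op x = F.map g'.op x ↔ g ≫ v = g' ≫ v := by
    intro W g g'
    rw [← sub_eq_zero, ← map_op_sub_apply, hz, Preadditive.sub_comp, sub_eq_zero]
  choose γ hγ using hx.generates
  refine ⟨V, ⟨fun W => AddCommGrpCat.ofHom
    { toFun := fun y => γ W.unop y ≫ v
      map_zero' := ?_
      map_add' := fun y z => ?_ }, ?_⟩, ?_⟩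
  · exact (hz _ _).mp (hγ _ _)
  · change _ = γ W.unop y ≫ v + γ W.unop z ≫ v
    rw [← Preadditive.add_comp, ← heq, hγ, map_op_add_apply, hγ, hγ]
  · intro W W' k
    ext y
    change γ W'.unop (F.map k y) ≫ v = k.unop ≫ γ W.unop y ≫ v
    rw [← Category.assoc, ← heq, hγ, map_op_comp_apply, hγ]
    rfl
  · intro W y z hyz
    change γ W.unop y ≫ v = γ W.unop z ≫ v at hyz
    rw [← heq, hγ, hγ] at hyz
    exact hyz

end FinPresFrobenius

/-! ### From the stable category to linear maps -/

section StableCategoryInterface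
open Limits

variable {R : Type u} [CommRing R] {C : ObjectProperty (ModuleCat.{u} R)}

/-- An object of `C` in the stable category. -/
def stableObj (X : ModuleCat.{u} R) (hX : C X) : StableCategory C :=
  (Quotient.functor (stableRel C)).obj ⟨X, hX⟩

theorem stableObj_surjective (X : StableCategory C) : ∃ Y, ∃ hY : C Y, X = stableObj Y hY :=
  ⟨X.as.obj, X.as.property, rfl⟩

/-- The class of a linear map in the stable category. -/
def stableMap {X Y : ModuleCat.{u} R} (hX : C X) (hY : C Y) (f : X →ₗ[R] Y) :
    stableObj X hX ⟶ stableObj Y hY :=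
  (Quotient.functor (stableRel C)).map (X := ⟨X, hX⟩) (Y := ⟨Y, hY⟩)
    (ObjectProperty.homMk (ModuleCat.ofHom f))

variable {X Y Z : ModuleCat.{u} R} (hX : C X) (hY : C Y) (hZ : C Z)

theorem stableMap_surjective : Function.Surjective (stableMap hX hY) := by
  intro f
  obtain ⟨g, hg⟩ := Functor.Full.map_surjective (F := Quotient.functor (stableRel C))
    (X := ⟨X, hX⟩) (Y := ⟨Y, hY⟩) f
  exact ⟨g.hom.hom, hg⟩

theorem stableMap_eq_iff (f g : X →ₗ[R] Y) :
    stableMap hX hY f = stableMap hX hY g ↔ (f - g).IsStablyZero := by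
  refine (Quotient.functor_map_eq_iff (stableRel C) (X := ⟨X, hX⟩) (Y := ⟨Y, hY⟩) _ _).trans ?_
  exact factorsThroughProjective_iff (ModuleCat.ofHom f - ModuleCat.ofHom g)

theorem stableMap_zero : stableMap hX hY 0 = 0 := rfl

theorem stableMap_eq_zero_iff (f : X →ₗ[R] Y) : stableMap hX hY f = 0 ↔ f.IsStablyZero := by
  rw [← stableMap_zero, stableMap_eq_iff, sub_zero]

theorem stableMap_id : stableMap hX hX LinearMap.id = 𝟙 _ := rfl

theorem stableMap_comp (f : X →ₗ[R] Y) (g : Y →ₗ[R] Z) :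
    stableMap hX hY f ≫ stableMap hY hZ g = stableMap hX hZ (g ∘ₗ f) := rfl

theorem IsSubcategory.hasZeroObject (hC : IsSubcategory C) : HasZeroObject (StableCategory C) := by
  have h0 : C (ModuleCat.of R PUnit.{u + 1}) := hC.of_projective _
    (inferInstanceAs (Module.Finite R PUnit.{u + 1}))
    (inferInstanceAs (Module.Projective R PUnit.{u + 1}))
  refine ⟨⟨stableObj _ h0, ?_⟩⟩
  rw [IsZero.iff_id_eq_zero, ← stableMap_id, stableMap_eq_zero_iff]
  exact LinearMap.IsStablyZero.id_of_projective PUnit.{u + 1}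

theorem IsSubcategory.prod_mem (hC : IsSubcategory C) (hX : C X) (hY : C Y) :
    C (ModuleCat.of R (X × Y)) :=
  (hC.sum_iff X Y (hC.finite _ hX) (hC.finite _ hY)).mpr ⟨hX, hY⟩

theorem IsSubcategory.hasBinaryBiproducts (hC : IsSubcategory C) :
    HasBinaryBiproducts (StableCategory C) := by
  refine ⟨fun P Q => ?_⟩
  obtain ⟨X, hX, rfl⟩ := stableObj_surjective P
  obtain ⟨Y, hY, rfl⟩ := stableObj_surjective Q
  have hZ := hC.prod_mem hX hY
  have e : ∀ (U V : ModuleCat.{u} R) (hU : C U) (hV : C V) (f g : U →ₗ[R] V), f = g →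
      stableMap hU hV f = stableMap hU hV g := fun U V hU hV f g h => by rw [h]
  exact hasBinaryBiproduct_of_total
    { pt := stableObj _ hZ
      fst := stableMap hZ hX (LinearMap.fst R X Y)
      snd := stableMap hZ hY (LinearMap.snd R X Y)
      inl := stableMap hX hZ (LinearMap.inl R X Y)
      inr := stableMap hY hZ (LinearMap.inr R X Y)
      inl_fst := e X X hX hX _ _ (LinearMap.fst_comp_inl R X Y)
      inl_snd := e X Y hX hY _ _ (LinearMap.snd_comp_inl R X Y)
      inr_fst := e Y X hY hX _ _ (LinearMap.fst_comp_inr R X Y)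
      inr_snd := e Y Y hY hY _ _ (LinearMap.snd_comp_inr R X Y) }
    (e _ _ hZ hZ (LinearMap.inl R X Y ∘ₗ LinearMap.fst R X Y +
      LinearMap.inr R X Y ∘ₗ LinearMap.snd R X Y) LinearMap.id (by ext <;> simp))

theorem IsSubcategory.of_retract (hC : IsSubcategory C) (i : X →ₗ[R] Y) (r : Y →ₗ[R] X)
    (h : ∀ x, r (i x) = x) (hY : C Y) : C X := by
  have := hC.finite _ hY
  have hX : Module.Finite R X := Module.Finite.of_surjective r fun x => ⟨_, h x⟩
  let e := LinearMap.equivKerProdOfLeftInverse i r h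
  have hk : Module.Finite R (LinearMap.ker r) := Module.Finite.of_surjective
    (LinearMap.fst R _ _ ∘ₗ e.toLinearMap) (Prod.fst_surjective.comp e.surjective)
  exact ((hC.sum_iff (ModuleCat.of R (LinearMap.ker r)) X hk hX).mp
    (hC.of_iso _ _ ⟨LinearEquiv.toModuleIso (X₁ := Y) (X₂ := (LinearMap.ker r) × X) e⟩ hY)).2

theorem IsSubcategory.of_linearEquiv (hC : IsSubcategory C) (e : X ≃ₗ[R] Y) (hX : C X) : C Y :=
  hC.of_iso _ _ ⟨e.toModuleIso⟩ hX

theorem IsSubcategory.free_mem (hC : IsSubcategory C) (n : ℕ) :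
    C (ModuleCat.of R (Fin n → R)) :=
  hC.of_projective _ (inferInstanceAs (Module.Finite R (Fin n → R)))
    (inferInstanceAs (Module.Projective R (Fin n → R)))

theorem IsSubcategory.ring_mem (hC : IsSubcategory C) : C (ModuleCat.of R R) :=
  hC.of_projective _ (inferInstanceAs (Module.Finite R R))
    (inferInstanceAs (Module.Projective R R))

theorem IsResolving.left_mem [IsNoetherianRing R] (hC : IsResolving C) {i : X →ₗ[R] Y}
    {p : Y →ₗ[R] Z} (h : IsShortExactPair i p) (hY : C Y) (hZ : C Z) : C X := by
  have := hC.finite _ hY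
  exact hC.kernel_closed _ h.shortExact h.finite_left this (hC.finite _ hZ) hY hZ

theorem IsResolving.middle_mem (hC : IsResolving C) {i : X →ₗ[R] Y}
    {p : Y →ₗ[R] Z} (h : IsShortExactPair i p) (hX : C X) (hZ : C Z) : C Y := by
  have := hC.finite _ hX
  have := hC.finite _ hZ
  exact hC.ext_closed _ h.shortExact (hC.finite _ hX) h.finite_middle (hC.finite _ hZ) hX hZ

/-- A map in a free module lifts along surjections. -/
theorem LinearMap.IsStablyZero.exists_lift {U V W : Type*} [AddCommGroup U] [Module R U]
    [AddCommGroup V] [Module R V] [AddCommGroup W] [Module R W] {f : U →ₗ[R] W}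
    (hf : f.IsStablyZero) (p : V →ₗ[R] W) (hp : Function.Surjective p) :
    ∃ g : U →ₗ[R] V, g.IsStablyZero ∧ ∀ x, p (g x) = f x := by
  obtain ⟨n, a, b, rfl⟩ := hf
  obtain ⟨c, hc⟩ := Module.projective_lifting_property p b hp
  exact ⟨c ∘ₗ a, ⟨n, a, c, rfl⟩, fun x => LinearMap.congr_fun hc (a x)⟩

/-- Adding a free cover of the target makes a map surjective without changing it stably; the kernel
of the enlarged map stays in `C`. -/
theorem IsResolving.weakKernelsExist [IsNoetherianRing R] (hC : IsResolving C) :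
    WeakKernelsExist (StableCategory C) := by
  intro P Q f
  obtain ⟨X, hX, rfl⟩ := stableObj_surjective P
  obtain ⟨Y, hY, rfl⟩ := stableObj_surjective Q
  obtain ⟨f, rfl⟩ := stableMap_surjective hX hY f
  have := hC.finite _ hY
  obtain ⟨n, π, hπ⟩ := Module.Finite.exists_fin' R Y
  have hp : Function.Surjective (f.coprod π) := fun y => by
    obtain ⟨z, rfl⟩ := hπ y
    exact ⟨(0, z), by simp⟩
  have hXP : C (ModuleCat.of R (X × (Fin n → R))) := hC.prod_mem hX (hC.free_mem n)
  have hZ : C (ModuleCat.of R (LinearMap.ker (f.coprod π))) :=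
    hC.left_mem (Y := ModuleCat.of R (X × (Fin n → R))) (Z := Y)
      (IsShortExactPair.of_surjective (f.coprod π) hp) hXP hY
  refine ⟨stableObj _ hZ,
    stableMap hZ hX (LinearMap.fst R X (Fin n → R) ∘ₗ (LinearMap.ker (f.coprod π)).subtype), ?_, ?_⟩
  · rw [stableMap_comp, stableMap_eq_zero_iff]
    refine ⟨n, LinearMap.snd R X (Fin n → R) ∘ₗ (LinearMap.ker (f.coprod π)).subtype, -π, ?_⟩
    ext z
    have := z.2
    rw [LinearMap.mem_ker, LinearMap.coprod_apply] at this
    simpa using (eq_neg_of_add_eq_zero_left this).symm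
  · intro W g hg
    obtain ⟨W, hW, rfl⟩ := stableObj_surjective W
    obtain ⟨g, rfl⟩ := stableMap_surjective hW hX g
    rw [stableMap_comp, stableMap_eq_zero_iff] at hg
    obtain ⟨b, -, hb⟩ := hg.exists_lift π hπ
    let h : W →ₗ[R] LinearMap.ker (f.coprod π) := (g.prod (-b)).codRestrict _ (fun x => by
      simp [hb])
    refine ⟨stableMap hW hZ h, ?_⟩
    rw [stableMap_comp]
    rfl

theorem IsResolving.exists_stable_retraction (hC : IsResolving C)
    (hF : IsFrobeniusCategory (FinPresFunctors (StableCategory C))) (hY : C Y) (hX : C X)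
    (p : Y →ₗ[R] X) (hp : ∀ (U : ModuleCat.{u} R) (_ : C U) (g : U →ₗ[R] Y),
      (p ∘ₗ g).IsStablyZero → g.IsStablyZero) :
    ∃ q : X →ₗ[R] Y, (q ∘ₗ p - LinearMap.id).IsStablyZero := by
  have := hC.hasZeroObject
  have := hC.hasBinaryBiproducts
  obtain ⟨q, hq⟩ := hF.exists_retraction (stableMap hY hX p) (fun U g hg => by
    obtain ⟨U, hU, rfl⟩ := stableObj_surjective U
    obtain ⟨g, rfl⟩ := stableMap_surjective hU hY g
    rw [stableMap_comp, stableMap_eq_zero_iff] at hg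
    exact (stableMap_eq_zero_iff _ _ _).mpr (hp U hU g hg))
  obtain ⟨q, rfl⟩ := stableMap_surjective hX hY q
  rw [stableMap_comp, ← stableMap_id, stableMap_eq_iff] at hq
  exact ⟨q, hq⟩

theorem IsResolving.exists_stable_weakCokernel (hC : IsResolving C)
    (hF : IsFrobeniusCategory (FinPresFunctors (StableCategory C))) (hY : C Y) (hX : C X)
    (f : Y →ₗ[R] X) : ∃ (V : ModuleCat.{u} R) (_ : C V) (v : X →ₗ[R] V),
      ∀ (U : ModuleCat.{u} R) (_ : C U) (g : U →ₗ[R] X),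
        (v ∘ₗ g).IsStablyZero ↔ ∃ k : U →ₗ[R] Y, (f ∘ₗ k - g).IsStablyZero := by
  have := hC.hasZeroObject
  have := hC.hasBinaryBiproducts
  obtain ⟨V, v, hv⟩ := hF.exists_weakCokernel (stableMap hY hX f)
  obtain ⟨V, hV, rfl⟩ := stableObj_surjective V
  obtain ⟨v, rfl⟩ := stableMap_surjective hX hV v
  refine ⟨V, hV, v, fun U hU g => ?_⟩
  rw [← stableMap_eq_zero_iff hU hV, ← stableMap_comp hU hX hV, hv]
  constructor
  · rintro ⟨k, hk⟩
    obtain ⟨k, rfl⟩ := stableMap_surjective hU hY k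
    exact ⟨k, by rwa [stableMap_comp, stableMap_eq_iff] at hk⟩
  · rintro ⟨k, hk⟩
    exact ⟨stableMap hU hY k, by rwa [stableMap_comp, stableMap_eq_iff]⟩

theorem IsResolving.isFrobeniusCategory [IsNoetherianRing R] (hC : IsResolving C)
    (h₁ : ∀ (Y X : ModuleCat.{u} R) (_ : C Y) (_ : C X) (p : Y →ₗ[R] X),
      (∀ (U : ModuleCat.{u} R) (_ : C U) (g : U →ₗ[R] Y),
        (p ∘ₗ g).IsStablyZero → g.IsStablyZero) →
      ∃ q : X →ₗ[R] Y, (q ∘ₗ p - LinearMap.id).IsStablyZero)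
    (h₂ : ∀ (Y X : ModuleCat.{u} R) (_ : C Y) (_ : C X) (f : Y →ₗ[R] X),
      ∃ (V : ModuleCat.{u} R) (_ : C V) (v : X →ₗ[R] V),
        ∀ (U : ModuleCat.{u} R) (_ : C U) (g : U →ₗ[R] X),
          (v ∘ₗ g).IsStablyZero ↔ ∃ k : U →ₗ[R] Y, (f ∘ₗ k - g).IsStablyZero) :
    IsFrobeniusCategory (FinPresFunctors (StableCategory C)) := by
  have := hC.hasZeroObject
  have := hC.hasBinaryBiproducts
  refine isFrobeniusCategory_finPresFunctors hC.weakKernelsExist ?_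
    (exists_embedding_of_weakCokernel ?_)
  · intro Y X p hp
    obtain ⟨Y, hY, rfl⟩ := stableObj_surjective Y
    obtain ⟨X, hX, rfl⟩ := stableObj_surjective X
    obtain ⟨p, rfl⟩ := stableMap_surjective hY hX p
    obtain ⟨q, hq⟩ := h₁ Y X hY hX p (fun U hU g hg => by
      rw [← stableMap_eq_zero_iff hU hY]
      apply hp
      rwa [stableMap_comp, stableMap_eq_zero_iff])
    exact ⟨stableMap hX hY q, by rwa [stableMap_comp, ← stableMap_id, stableMap_eq_iff]⟩
  · intro Y X f
    obtain ⟨Y, hY, rfl⟩ := stableObj_surjective Y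
    obtain ⟨X, hX, rfl⟩ := stableObj_surjective X
    obtain ⟨f, rfl⟩ := stableMap_surjective hY hX f
    obtain ⟨V, hV, v, hv⟩ := h₂ Y X hY hX f
    refine ⟨stableObj V hV, stableMap hX hV v, fun U g => ?_⟩
    obtain ⟨U, hU, rfl⟩ := stableObj_surjective U
    obtain ⟨g, rfl⟩ := stableMap_surjective hU hX g
    rw [stableMap_comp, stableMap_eq_zero_iff, hv U hU]
    constructor
    · rintro ⟨k, hk⟩
      exact ⟨stableMap hU hY k, by rwa [stableMap_comp, stableMap_eq_iff]⟩
    · rintro ⟨k, hk⟩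
      obtain ⟨k, rfl⟩ := stableMap_surjective hU hY k
      exact ⟨k, by rwa [stableMap_comp, stableMap_eq_iff] at hk⟩

end StableCategoryInterface

/-! ### Vanishing of extensions by the ring -/

section FrobeniusResolving
open IsLocalRing

variable {R : Type u} [CommRing R]

namespace IsShortExactPair

/-- Rotation of a short exact sequence in the stable category. -/
theorem exists_rotation {A B W K P : Type*} [AddCommGroup A] [Module R A] [AddCommGroup B]
    [Module R B] [AddCommGroup W] [Module R W] [AddCommGroup K] [Module R K] [AddCommGroup P]
    [Module R P] [Module.Projective R P] {i : A →ₗ[R] B} {p : B →ₗ[R] W} {j : K →ₗ[R] P}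
    {π : P →ₗ[R] W} (h : IsShortExactPair i p) (h' : IsShortExactPair j π) :
    ∃ (t : K →ₗ[R] A) (s : P →ₗ[R] B), (∀ x, p (s x) = π x) ∧ (∀ x, i (t x) = s (j x)) ∧
      ∀ (U : Type u) [AddCommGroup U] [Module R U] (g : U →ₗ[R] A), (i ∘ₗ g).IsStablyZero →
        ∃ n : U →ₗ[R] K, (g - t ∘ₗ n).IsStablyZero := by
  obtain ⟨s, hs⟩ := Module.projective_lifting_property p π h.surjective
  have hs : ∀ x, p (s x) = π x := fun x => LinearMap.congr_fun hs x
  obtain ⟨t, ht⟩ := h.exists_lift (s ∘ₗ j) (fun x => by simp [hs, h'.apply_apply])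
  refine ⟨t, s, hs, ht, fun U _ _ g hg => ?_⟩
  obtain ⟨N, a, b, hab⟩ := hg
  have hab : ∀ x, b (a x) = i (g x) := fun x => LinearMap.congr_fun hab x
  obtain ⟨l, hl⟩ := Module.projective_lifting_property π (p ∘ₗ b) h'.surjective
  have hl : ∀ x, π (l x) = p (b x) := fun x => LinearMap.congr_fun hl x
  obtain ⟨m, hm⟩ := h.exists_lift (b - s ∘ₗ l) (fun x => by simp [hs, hl])
  obtain ⟨n, hn⟩ := h'.exists_lift (l ∘ₗ a) (fun x => by simp [hl, hab, h.apply_apply])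
  -- The difference $g-t\circ n$ factors through the same free module as $i\circ g$, with `m` in
  -- place of `b`.
  refine ⟨n, N, a, m, LinearMap.ext fun x => h.injective ?_⟩
  have e1 := hm (a x)
  have e2 := ht (n x)
  have e3 := hn x
  simp only [LinearMap.sub_apply, LinearMap.comp_apply] at e1 e2 e3 ⊢
  rw [e1, map_sub, e2, e3, hab]

theorem exists_retraction_of_projective {A B W : Type*} [AddCommGroup A] [Module R A]
    [AddCommGroup B] [Module R B] [AddCommGroup W] [Module R W] [Module.Projective R W]
    {i : A →ₗ[R] B} {p : B →ₗ[R] W} (h : IsShortExactPair i p) :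
    ∃ r : B →ₗ[R] A, ∀ x, r (i x) = x := by
  obtain ⟨s, hs⟩ := Module.projective_lifting_property p LinearMap.id h.surjective
  have hs : ∀ x, p (s x) = x := fun x => LinearMap.congr_fun hs x
  obtain ⟨r, hr⟩ := h.exists_lift (LinearMap.id - s ∘ₗ p) (fun x => by simp [hs])
  refine ⟨r, fun x => h.injective ?_⟩
  simp [hr, h.apply_apply]

/-- The kernel of the second map is stably a subobject of the middle term if the cokernel has
projective dimension at most one. -/
theorem isStablyZero_of_comp {A B W K P : Type u} [AddCommGroup A] [Module R A] [AddCommGroup B]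
    [Module R B] [AddCommGroup W] [Module R W] [AddCommGroup K] [Module R K] [AddCommGroup P]
    [Module R P] [Module.Projective R P] [Module.Finite R K] [Module.Projective R K]
    {i : A →ₗ[R] B} {p : B →ₗ[R] W} {j : K →ₗ[R] P} {π : P →ₗ[R] W} (h : IsShortExactPair i p)
    (h' : IsShortExactPair j π) {U : Type u} [AddCommGroup U] [Module R U] (g : U →ₗ[R] A)
    (hg : (i ∘ₗ g).IsStablyZero) : g.IsStablyZero := by
  obtain ⟨t, s, -, -, ht⟩ := h.exists_rotation h'
  obtain ⟨n, hn⟩ := ht U g hg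
  rw [← sub_add_cancel g (t ∘ₗ n)]
  exact hn.add ((LinearMap.IsStablyZero.of_projective_target n).comp_left t)

end IsShortExactPair

theorem exists_surjective_residue [IsLocalRing R] (M : Type*) [AddCommGroup M] [Module R M]
    [Module.Finite R M] [Nontrivial M] :
    ∃ f : M →ₗ[R] R ⧸ maximalIdeal R, Function.Surjective f := by
  obtain ⟨N, hN⟩ := IsCoatomic.exists_coatom (Submodule R M)
  have : IsSimpleModule R (M ⧸ N) := isSimpleModule_iff_isCoatom.mpr hN
  obtain ⟨I, hI, ⟨e⟩⟩ := isSimpleModule_iff_quot_maximal.mp this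
  obtain rfl := IsLocalRing.eq_maximalIdeal hI
  exact ⟨e.toLinearMap ∘ₗ N.mkQ, e.surjective.comp N.mkQ_surjective⟩

/-- A map of finite projective modules `K → P` is split if all maps from `K` to some nonzero finite
module extend to `P`. -/
theorem exists_retraction_of_forall_extension [IsLocalRing R] {K P X : Type*} [AddCommGroup K]
    [Module R K] [Module.Finite R K] [Module.Projective R K] [AddCommGroup P] [Module R P]
    [Module.Projective R P] [AddCommGroup X] [Module R X] [Module.Finite R X] [Nontrivial X]
    (j : K →ₗ[R] P) (h : ∀ f : K →ₗ[R] X, ∃ g : P →ₗ[R] X, ∀ x, g (j x) = f x) :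
    ∃ r : P →ₗ[R] K, ∀ x, r (j x) = x := by
  obtain ⟨n, b, a, -, -, hba⟩ := Module.Finite.exists_comp_eq_id_of_projective R K
  obtain ⟨l, hl⟩ := exists_surjective_residue (R := R) X
  -- Each coordinate of `K` modulo the maximal ideal lifts through `X`, since `K` is projective and
  -- `X` maps onto the residue field. Extending that lift to `P` by hypothesis and lifting its
  -- residue to `R` gives `c`.
  have key : ∀ k : Fin n, ∃ c : P →ₗ[R] R, ∀ x, c (j x) - a x k ∈ maximalIdeal R := by
    intro k
    obtain ⟨f, hf⟩ := Module.projective_lifting_property l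
      ((maximalIdeal R).mkQ ∘ₗ LinearMap.proj k ∘ₗ a) hl
    obtain ⟨g, hg⟩ := h f
    obtain ⟨c, hc⟩ := Module.projective_lifting_property (maximalIdeal R).mkQ (l ∘ₗ g)
      (maximalIdeal R).mkQ_surjective
    refine ⟨c, fun x => (Submodule.Quotient.eq (maximalIdeal R)).mp ?_⟩
    have h1 := LinearMap.congr_fun hc (j x)
    have h2 := LinearMap.congr_fun hf x
    simp only [LinearMap.comp_apply] at h1 h2
    rw [hg, h2] at h1
    exact h1
  choose c hc using key
  have hbij : Function.Bijective ((b ∘ₗ LinearMap.pi c) ∘ₗ j) := by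
    apply LinearMap.bijective_of_sub_mem
    intro x
    have hx : b (a x) = x := LinearMap.congr_fun hba x
    have : ((b ∘ₗ LinearMap.pi c) ∘ₗ j) x - x = b (fun k => c k (j x) - a x k) := by
      calc _ = b (LinearMap.pi c (j x)) - b (a x) := by rw [hx]; rfl
        _ = _ := by rw [← map_sub]; rfl
    rw [this, LinearMap.pi_apply_eq_sum_univ b]
    exact Submodule.sum_mem _ fun i _ => Submodule.smul_mem_smul (hc i x) Submodule.mem_top
  let e := LinearEquiv.ofBijective _ hbij
  exact ⟨e.symm.toLinearMap ∘ₗ b ∘ₗ LinearMap.pi c, fun x => e.symm_apply_apply x⟩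

variable {C : ObjectProperty (ModuleCat.{u} R)}

theorem Module.Projective.of_linearEquiv_prod {M N L : Type*} [AddCommGroup M] [Module R M]
    [AddCommGroup N] [Module R N] [AddCommGroup L] [Module R L] [Module.Projective R M]
    (e : M ≃ₗ[R] N × L) : Module.Projective R L :=
  Module.Projective.of_split (e.symm.toLinearMap ∘ₗ LinearMap.inr R N L)
    (LinearMap.snd R N L ∘ₗ e.toLinearMap) (by ext x; simp)

/-- If finitely presented functors on the stable category of `C` form a Frobenius category, modules
in `C` of projective dimension at most one are projective. -/
theorem IsResolving.projective_of_projectiveDimension_le_one [IsNoetherianRing R] [IsLocalRing R]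
    (hC : IsResolving C) (hF : IsFrobeniusCategory (FinPresFunctors (StableCategory C)))
    {X : ModuleCat.{u} R} (hX : C X) {K P : Type u} [AddCommGroup K] [Module R K]
    [Module.Finite R K] [Module.Projective R K] [AddCommGroup P] [Module R P] [Module.Finite R P]
    [Module.Projective R P] {j : K →ₗ[R] P} {π : P →ₗ[R] X} (h : IsShortExactPair j π) :
    Module.Projective R X := by
  have := hC.finite _ hX
  obtain ⟨X₀, n, hfin, hX₀, ⟨e⟩⟩ := exists_noFreeSummand_prod_free (R := R) X
  have hCX₀ : C X₀ := hC.of_retract (e.symm.toLinearMap ∘ₗ LinearMap.inl R X₀ (Fin n → R))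
    (LinearMap.fst R X₀ (Fin n → R) ∘ₗ e.toLinearMap) (fun x => by simp) hX
  suffices Module.Projective R X₀ from Module.Projective.of_equiv e.symm
  cases subsingleton_or_nontrivial X₀ with
  | inl hs => exact inferInstance
  | inr hn =>
  let π₀ : P →ₗ[R] X₀ := LinearMap.fst R X₀ (Fin n → R) ∘ₗ e.toLinearMap ∘ₗ π
  have h₀ := IsShortExactPair.of_surjective π₀
    (Prod.fst_surjective.comp (e.surjective.comp h.surjective))
  -- Discarding the free summand of `X` enlarges the kernel to an extension of $R^n$ by `K`.
  have hK : Module.Projective R (LinearMap.ker π₀) := by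
    let q : LinearMap.ker π₀ →ₗ[R] (Fin n → R) :=
      (LinearMap.snd R X₀ (Fin n → R) ∘ₗ e.toLinearMap ∘ₗ π) ∘ₗ (LinearMap.ker π₀).subtype
    let j' : K →ₗ[R] LinearMap.ker π₀ := j.codRestrict _ (fun x => by simp [π₀, h.apply_apply])
    have hj : IsShortExactPair j' q := by
      refine ⟨fun x y hxy => h.injective (congrArg Subtype.val hxy), fun y => ?_, fun z => ?_⟩
      · constructor
        · intro hy
          have hz : π (y : P) = 0 := by
            apply e.injective
            rw [map_zero]
            exact Prod.ext y.2 hy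
          obtain ⟨x, hx⟩ := (h.exact _).mp hz
          exact ⟨x, Subtype.ext hx⟩
        · rintro ⟨x, rfl⟩
          simp [q, j', h.apply_apply]
      · obtain ⟨y, hy⟩ := h.surjective (e.symm (0, z))
        exact ⟨⟨y, by simp [π₀, hy]⟩, by simp [q, hy]⟩
    obtain ⟨e'⟩ := hj.equiv_of_projective
    exact Module.Projective.of_equiv e'.symm
  have hfK : Module.Finite R (LinearMap.ker π₀) := h₀.finite_left
  -- In a self-extension of $X_0$ the inclusion is a stable monomorphism, because the syzygy of the
  -- quotient is projective. Its stable retraction is a true one up to an automorphism, as $X_0$ has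
  -- no free summand.
  have hsplit : ExtVanishes X₀ X₀ 1 := by
    refine extVanishes_one_of_split X₀ X₀ fun Y i p hY hse => ?_
    have hCY : C Y := hC.middle_mem hse hCX₀ hCX₀
    obtain ⟨q, hq⟩ := hC.exists_stable_retraction hF hCX₀ hCY i
      (fun U _ g hg => hse.isStablyZero_of_comp h₀ g hg)
    have hb := hq.bijective_of_sub_id hX₀
    let θ := LinearEquiv.ofBijective _ hb
    exact ⟨θ.symm.toLinearMap ∘ₗ q, fun x => θ.symm_apply_apply x⟩
  obtain ⟨r, hr⟩ := exists_retraction_of_forall_extension (X := X₀) (LinearMap.ker π₀).subtype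
    (fun f => IsShortExactPair.exists_extension (A := ModuleCat.of R (LinearMap.ker π₀))
      (B := ModuleCat.of R P) (W := X₀) h₀ hsplit f)
  obtain ⟨e'⟩ := h₀.equiv_of_retraction r hr
  exact Module.Projective.of_linearEquiv_prod e'

/-- Up to a common summand $Y_0$ of `Y` and `X`, the sequence is $0\to R\to R^n\to X'\to 0$; here
$X'$ lies in `C` and has projective dimension at most one, hence is projective. -/
theorem IsResolving.exists_retraction_ring [IsNoetherianRing R] [IsLocalRing R]
    (hC : IsResolving C) (hF : IsFrobeniusCategory (FinPresFunctors (StableCategory C)))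
    {X Y : ModuleCat.{u} R} (hX : C X) {i : R →ₗ[R] Y} {p : Y →ₗ[R] X}
    (h : IsShortExactPair i p) : ∃ r : Y →ₗ[R] R, ∀ x, r (i x) = x := by
  have hY : C Y := hC.middle_mem (X := ModuleCat.of R R) h hC.ring_mem hX
  have := hC.finite _ hY
  -- If $p\circ g$ is stably zero, then `g` differs from a stably zero lift by a map through $\ker
  -- p\cong R$, so `p` is a stable monomorphism.
  obtain ⟨q, hq⟩ := hC.exists_stable_retraction hF hY hX p (fun U _ g hg => by
    obtain ⟨g', hg', hpg⟩ := hg.exists_lift p h.surjective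
    obtain ⟨m, hm⟩ := h.exists_lift (g - g') (fun x => by simp [hpg])
    have : g = i ∘ₗ m + g' := by ext x; simp [hm]
    rw [this]
    exact ((LinearMap.IsStablyZero.of_projective_target m).comp_left i).add hg')
  obtain ⟨Y₀, n, hfin, hY₀, ⟨e⟩⟩ := exists_noFreeSummand_prod_free (R := R) Y
  let ι : Y₀ →ₗ[R] Y := e.symm.toLinearMap ∘ₗ LinearMap.inl R Y₀ (Fin n → R)
  let ρ : Y →ₗ[R] Y₀ := LinearMap.fst R Y₀ (Fin n → R) ∘ₗ e.toLinearMap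
  let ιF : (Fin n → R) →ₗ[R] Y := e.symm.toLinearMap ∘ₗ LinearMap.inr R Y₀ (Fin n → R)
  let ρF : Y →ₗ[R] (Fin n → R) := LinearMap.snd R Y₀ (Fin n → R) ∘ₗ e.toLinearMap
  have hρι : ∀ x, ρ (ι x) = x := fun x => by simp [ρ, ι]
  have hρFι : ∀ x, ρF (ι x) = 0 := fun x => by simp [ρF, ι]
  have hρFιF : ∀ x, ρF (ιF x) = x := fun x => by simp [ρF, ιF]
  have hdec : ∀ y, ι (ρ y) + ιF (ρF y) = y := fun y => by
    apply e.injective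
    ext <;> simp [ι, ρ, ιF, ρF]
  have hb : Function.Bijective (ρ ∘ₗ q ∘ₗ p ∘ₗ ι) := by
    apply LinearMap.IsStablyZero.bijective_of_sub_id hY₀
    have : ρ ∘ₗ q ∘ₗ p ∘ₗ ι - LinearMap.id = ρ ∘ₗ (q ∘ₗ p - LinearMap.id) ∘ₗ ι := by
      ext x; simp [hρι]
    rw [this]
    exact (hq.comp_right ι).comp_left ρ
  let θ := LinearEquiv.ofBijective _ hb
  -- `σ` retracts $p\circ\iota$, so $Y_0$ is a summand of `X` with complement $\ker\sigma$ and
  -- projection `κ`.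
  let σ : X →ₗ[R] Y₀ := θ.symm.toLinearMap ∘ₗ ρ ∘ₗ q
  have hσ : ∀ y, σ (p (ι y)) = y := fun y => θ.symm_apply_apply y
  let κ : X →ₗ[R] LinearMap.ker σ :=
    (LinearMap.id - p ∘ₗ ι ∘ₗ σ).codRestrict _ (fun x => by simp [hσ])
  have hκ : ∀ x, (κ x : X) = x - p (ι (σ x)) := fun x => rfl
  have hκker : ∀ x : LinearMap.ker σ, κ x = x := fun x => by
    ext1
    rw [hκ, LinearMap.mem_ker.mp x.2]
    simp
  have hκι : ∀ y, κ (p (ι y)) = 0 := fun y => by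
    ext1
    rw [hκ, hσ, sub_self]; rfl
  have hse : IsShortExactPair (ρF ∘ₗ i) (κ ∘ₗ p ∘ₗ ιF) := by
    refine ⟨?_, fun v => ⟨fun hv => ?_, ?_⟩, fun x => ?_⟩
    · rw [← LinearMap.ker_eq_bot, LinearMap.ker_eq_bot']
      intro r hr
      have hr : ρF (i r) = 0 := hr
      have h1 := hdec (i r)
      rw [hr, map_zero, add_zero] at h1
      have h2 := hσ (ρ (i r))
      rw [h1, h.apply_apply, map_zero] at h2
      rw [← h2, map_zero] at h1
      exact h.injective (by rw [← h1, map_zero])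
    · have hv := congrArg Subtype.val hv
      change p (ιF v) - p (ι (σ (p (ιF v)))) = 0 at hv
      rw [← map_sub] at hv
      obtain ⟨r, hr⟩ := (h.exact _).mp hv
      refine ⟨r, ?_⟩
      change ρF (i r) = v
      rw [hr, map_sub, hρFι, hρFιF, sub_zero]
    · rintro ⟨r, rfl⟩
      have h1 := hdec (i r)
      have : ιF (ρF (i r)) = i r - ι (ρ (i r)) := eq_sub_of_add_eq' h1
      change κ (p (ιF (ρF (i r)))) = 0
      rw [this, map_sub, h.apply_apply, map_sub, hκι, map_zero, sub_zero]
    · obtain ⟨y, hy⟩ := h.surjective (x : X)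
      refine ⟨ρF y, ?_⟩
      change κ (p (ιF (ρF y))) = x
      have := hκker x
      rw [← hy, ← hdec y, map_add, map_add, hκι, zero_add] at this
      exact this
  have hCk : C (ModuleCat.of R (LinearMap.ker σ)) :=
    hC.of_retract (Y := X) (LinearMap.ker σ).subtype κ hκker hX
  have := hC.projective_of_projectiveDimension_le_one hF hCk hse
  have : Module.Projective R (LinearMap.ker σ) := this
  obtain ⟨r, hr⟩ := hse.exists_retraction_of_projective
  exact ⟨r ∘ₗ ρF, hr⟩

/-- Vanishing of `Ext¹` on a resolving subcategory implies vanishing of all higher `Ext`. -/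
theorem IsResolving.extVanishes_of_one [IsNoetherianRing R] (hC : IsResolving C)
    {N : ModuleCat.{u} R} (hN : ∀ X, C X → ExtVanishes X N 1) (n : ℕ) :
    ∀ X, C X → ExtVanishes X N (n + 1) := by
  induction n with
  | zero => exact hN
  | succ n ih =>
    intro X hX
    have := hC.finite _ hX
    obtain ⟨m, π, hπ⟩ := Module.Finite.exists_fin' R X
    have h := IsShortExactPair.of_surjective π hπ
    have hp : Module.Projective R (ModuleCat.of R (Fin m → R)) :=
      inferInstanceAs (Module.Projective R (Fin m → R))
    exact IsShortExactPair.extVanishes_right (A := ModuleCat.of R (LinearMap.ker π))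
      (B := ModuleCat.of R (Fin m → R)) h (extVanishes_of_projective _ _ _)
      (ih _ (hC.left_mem (X := ModuleCat.of R (LinearMap.ker π))
        (Y := ModuleCat.of R (Fin m → R)) h (hC.free_mem m) hX))

theorem IsResolving.extVanishes_ring [IsNoetherianRing R] [IsLocalRing R]
    (hC : IsResolving C) (hF : IsFrobeniusCategory (FinPresFunctors (StableCategory C)))
    {X : ModuleCat.{u} R} (hX : C X) (n : ℕ) : ExtVanishes X (ModuleCat.of R R) (n + 1) := by
  refine hC.extVanishes_of_one (fun X hX => ?_) n X hX
  have := hC.finite _ hX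
  have : Module.Finite R (ModuleCat.of R R) := inferInstanceAs (Module.Finite R R)
  exact extVanishes_one_of_split X (ModuleCat.of R R) fun Y i p _ hse =>
    hC.exists_retraction_ring hF hX hse

end FrobeniusResolving

/-! ### Existence of cosyzygies -/

section Cosyzygies
open IsLocalRing

variable {R : Type u} [CommRing R] {C : ObjectProperty (ModuleCat.{u} R)}

/-- `X` embeds into a finite projective module with cokernel in `C`. -/
def HasCosyzygy (C : ObjectProperty (ModuleCat.{u} R)) (X : ModuleCat.{u} R) : Prop :=
  ∃ (P X' : ModuleCat.{u} R) (i : X →ₗ[R] P) (p : P →ₗ[R] X'), Module.Finite R P ∧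
    Module.Projective R P ∧ C X' ∧ IsShortExactPair i p

theorem IsShortExactPair.prodMap {A B W A' B' W' : Type*} [AddCommGroup A] [Module R A]
    [AddCommGroup B] [Module R B] [AddCommGroup W] [Module R W] [AddCommGroup A'] [Module R A']
    [AddCommGroup B'] [Module R B'] [AddCommGroup W'] [Module R W'] {i : A →ₗ[R] B}
    {p : B →ₗ[R] W} {i' : A' →ₗ[R] B'} {p' : B' →ₗ[R] W'} (h : IsShortExactPair i p)
    (h' : IsShortExactPair i' p') : IsShortExactPair (i.prodMap i') (p.prodMap p') := by
  refine ⟨Function.Injective.prodMap h.injective h'.injective, ?_,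
    Function.Surjective.prodMap h.surjective h'.surjective⟩
  rintro ⟨b, b'⟩
  constructor
  · intro hb
    obtain ⟨a, rfl⟩ := (h.exact b).mp (congrArg Prod.fst hb)
    obtain ⟨a', rfl⟩ := (h'.exact b').mp (congrArg Prod.snd hb)
    exact ⟨(a, a'), rfl⟩
  · rintro ⟨⟨a, a'⟩, hab⟩
    rw [← hab]
    simp [h.apply_apply, h'.apply_apply]

theorem HasCosyzygy.prod (hC : IsSubcategory C) {X Y : ModuleCat.{u} R} (hX : HasCosyzygy C X)
    (hY : HasCosyzygy C Y) : HasCosyzygy C (ModuleCat.of R (X × Y)) := by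
  obtain ⟨P, X', i, p, _, _, hX', h⟩ := hX
  obtain ⟨P', Y', i', p', _, _, hY', h'⟩ := hY
  exact ⟨ModuleCat.of R (P × P'), ModuleCat.of R (X' × Y'), i.prodMap i', p.prodMap p',
    inferInstanceAs (Module.Finite R (P × P')), inferInstanceAs (Module.Projective R (P × P')),
    hC.prod_mem hX' hY', h.prodMap h'⟩

theorem HasCosyzygy.of_linearEquiv {X Y : ModuleCat.{u} R} (hX : HasCosyzygy C X)
    (e : X ≃ₗ[R] Y) : HasCosyzygy C Y := by
  obtain ⟨P, X', i, p, h1, h2, hX', h⟩ := hX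
  refine ⟨P, X', i ∘ₗ e.symm.toLinearMap, p, h1, h2, hX', h.injective.comp e.symm.injective,
    fun y => (h.exact y).trans ?_, h.surjective⟩
  constructor
  · rintro ⟨x, rfl⟩
    exact ⟨e x, by simp⟩
  · rintro ⟨x, rfl⟩
    exact ⟨e.symm x, rfl⟩

theorem HasCosyzygy.of_projective (hC : IsSubcategory C) (X : ModuleCat.{u} R) [Module.Finite R X]
    [Module.Projective R X] : HasCosyzygy C X :=
  ⟨X, ModuleCat.of R PUnit.{u + 1}, LinearMap.id, 0, ‹_›, ‹_›,
    hC.of_projective _ (inferInstanceAs (Module.Finite R PUnit.{u + 1}))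
      (inferInstanceAs (Module.Projective R PUnit.{u + 1})),
    Function.injective_id, fun y => ⟨fun _ => ⟨y, rfl⟩, fun _ => rfl⟩, fun y => ⟨0, rfl⟩⟩

/-- A direct summand of a syzygy of a module in `C` has a cosyzygy in `C`. -/
theorem HasCosyzygy.of_retract_syzygy [IsNoetherianRing R] (hC : IsResolving C)
    {X V : ModuleCat.{u} R} (hV : C V) {n : ℕ} {π : (Fin n → R) →ₗ[R] V}
    (hπ : Function.Surjective π) (a : X →ₗ[R] LinearMap.ker π) (c : LinearMap.ker π →ₗ[R] X)
    (hca : ∀ x, c (a x) = x) : HasCosyzygy C X := by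
  let i : X →ₗ[R] (Fin n → R) := (LinearMap.ker π).subtype ∘ₗ a
  have hi : Function.Injective i :=
    Subtype.coe_injective.comp (Function.LeftInverse.injective hca)
  have hse := IsShortExactPair.of_surjective π hπ
  have hΩ : C (ModuleCat.of R (LinearMap.ker π)) :=
    hC.left_mem (X := ModuleCat.of R (LinearMap.ker π)) (Y := ModuleCat.of R (Fin n → R)) hse
      (hC.free_mem n) hV
  have hk : C (ModuleCat.of R (LinearMap.ker c)) := by
    refine hC.of_retract (Y := ModuleCat.of R (LinearMap.ker π)) (LinearMap.ker c).subtype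
      ((LinearMap.id - a ∘ₗ c).codRestrict _ (fun x => by simp [hca])) (fun x => ?_) hΩ
    ext1
    simp
  let N := LinearMap.range i
  have hπi : N ≤ LinearMap.ker π := by
    rintro _ ⟨x, rfl⟩
    exact (a x).2
  -- The cokernel of $X\to R^n$ is an extension of `V` by $\ker c$, the complement of `X` in the
  -- syzygy of `V`.
  have hX' : C (ModuleCat.of R ((Fin n → R) ⧸ N)) := by
    refine hC.middle_mem (X := ModuleCat.of R (LinearMap.ker c)) (Z := V)
      (Y := ModuleCat.of R ((Fin n → R) ⧸ N))
      (i := N.mkQ ∘ₗ (LinearMap.ker π).subtype ∘ₗ (LinearMap.ker c).subtype)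
      (p := N.liftQ π hπi) ⟨?_, ?_, ?_⟩ hk hV
    · rw [← LinearMap.ker_eq_bot, LinearMap.ker_eq_bot']
      intro z hz
      obtain ⟨x, hx⟩ := (Submodule.Quotient.mk_eq_zero N).mp hz
      have hx' : a x = (z : LinearMap.ker π) := Subtype.ext hx
      have h0 : x = 0 := by rw [← hca x, hx']; exact z.2
      ext1
      rw [← hx', h0, map_zero]; rfl
    · intro y
      obtain ⟨y, rfl⟩ := N.mkQ_surjective y
      constructor
      · intro hy
        have hy : π y = 0 := hy
        refine ⟨⟨⟨y, hy⟩ - a (c ⟨y, hy⟩), by simp [hca]⟩, ?_⟩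
        refine (Submodule.Quotient.eq N).mpr ⟨-c ⟨y, hy⟩, ?_⟩
        simp [i]
      · rintro ⟨z, hz⟩
        rw [← hz]
        simp
    · intro w
      obtain ⟨y, rfl⟩ := hπ w
      exact ⟨N.mkQ y, rfl⟩
  refine ⟨ModuleCat.of R (Fin n → R), ModuleCat.of R ((Fin n → R) ⧸ N), i, N.mkQ,
    inferInstanceAs (Module.Finite R (Fin n → R)),
    inferInstanceAs (Module.Projective R (Fin n → R)), hX', hi, ?_, N.mkQ_surjective⟩
  rw [LinearMap.exact_iff, Submodule.ker_mkQ]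

/-- A nonsplit extension of some `W` by `X` is compared with an extension of `W` by a syzygy.
Locality of the endomorphism ring of `X` forces `X` to be a summand of that syzygy. -/
theorem IsResolving.hasCosyzygy_of_indecomposable [IsNoetherianRing R] [HenselianLocalRing R]
    (hC : IsResolving C) (hF : IsFrobeniusCategory (FinPresFunctors (StableCategory C)))
    (hE : NoExtInjectiveNonprojective C) {X : ModuleCat.{u} R} (hX : C X)
    (hind : IsIndecomposableModule R X) : HasCosyzygy C X := by
  have := hC.finite _ hX
  by_cases hp : Module.Projective R X
  · exact HasCosyzygy.of_projective hC.toIsSubcategory X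
  obtain ⟨W, hW, hWX⟩ : ∃ W, C W ∧ ¬ ExtVanishes W X 1 := by
    by_contra! hcon
    exact hE ⟨X, hX, hp, hcon⟩
  have := hC.finite _ hW
  obtain ⟨Y, i, p, hse, hns⟩ : ∃ (Y : ModuleCat.{u} R) (i : X →ₗ[R] Y) (p : Y →ₗ[R] W),
      IsShortExactPair i p ∧ ¬ ∃ r : Y →ₗ[R] X, ∀ x, r (i x) = x := by
    by_contra! hcon
    refine hWX (extVanishes_one_of_split W X fun Y i p _ h => ?_)
    by_contra! hr
    obtain ⟨r, hr'⟩ := hcon Y i p h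
    obtain ⟨x, hx⟩ := hr r
    exact hx (hr' x)
  have hY : C Y := hC.middle_mem hse hX hW
  obtain ⟨V, hV, v, hv⟩ := hC.exists_stable_weakCokernel hF hY hW p
  have := hC.finite _ hV
  obtain ⟨n, π, hπ⟩ := Module.Finite.exists_fin' R V
  -- `K` is the pullback of `v` and the free cover of `V`, an extension of `W` by $\Omega V$.
  let K := LinearMap.ker (v.coprod (-π))
  have hsurj : Function.Surjective (v.coprod (-π)) := fun y => by
    obtain ⟨z, rfl⟩ := hπ y
    exact ⟨(0, -z), by simp⟩
  have hK : C (ModuleCat.of R K) :=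
    hC.left_mem (X := ModuleCat.of R K) (Y := ModuleCat.of R (W × (Fin n → R))) (Z := V)
      (IsShortExactPair.of_surjective (v.coprod (-π)) hsurj) (hC.prod_mem hW (hC.free_mem n)) hV
  have hKmem : ∀ x : K, v (x : W × (Fin n → R)).1 = π (x : W × (Fin n → R)).2 := fun x => by
    have := x.2
    rw [LinearMap.mem_ker, LinearMap.coprod_apply, LinearMap.neg_apply, ← sub_eq_add_neg,
      sub_eq_zero] at this
    exact this
  let p₂ : K →ₗ[R] W := LinearMap.fst R W (Fin n → R) ∘ₗ K.subtype
  let i₂ : LinearMap.ker π →ₗ[R] K :=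
    (LinearMap.inr R W (Fin n → R) ∘ₗ (LinearMap.ker π).subtype).codRestrict K (fun x => by
      simp [K])
  have hse₂ : IsShortExactPair i₂ p₂ := by
    refine ⟨fun x y hxy => ?_, fun y => ⟨fun hy => ?_, ?_⟩, fun w => ?_⟩
    · ext1
      exact congrArg (fun z : K => (z : W × (Fin n → R)).2) hxy
    · have h1 := hKmem y
      have hy : (y : W × (Fin n → R)).1 = 0 := hy
      rw [hy, map_zero] at h1
      exact ⟨⟨_, h1.symm⟩, Subtype.ext (Prod.ext hy.symm rfl)⟩
    · rintro ⟨x, rfl⟩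
      rfl
    · obtain ⟨z, hz⟩ := hπ (v w)
      exact ⟨⟨(w, z), by simp [K, hz]⟩, rfl⟩
  -- Composed with `v`, the map `p₂` factors through a free module, so it factors stably through
  -- `p`. The error lifts along the surjection `p` and is subtracted to make the triangle strict.
  obtain ⟨k', hk'⟩ : ∃ k' : K →ₗ[R] Y, ∀ x, p (k' x) = p₂ x := by
    obtain ⟨k, hk⟩ := (hv (ModuleCat.of R K) hK p₂).mp
      ⟨n, LinearMap.snd R W (Fin n → R) ∘ₗ K.subtype, π, by
        ext x; exact (hKmem x).symm⟩
    obtain ⟨l, -, hl⟩ := hk.exists_lift p hse.surjective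
    exact ⟨k - l, fun x => by rw [LinearMap.sub_apply, map_sub, hl]; simp⟩
  obtain ⟨k₂, hk₂⟩ : ∃ k₂ : Y →ₗ[R] K, ∀ y, p₂ (k₂ y) = p y := by
    have hz : (v ∘ₗ p).IsStablyZero := (hv Y hY p).mpr
      ⟨LinearMap.id, 0, 0, 0, by ext; simp⟩
    obtain ⟨b, -, hb⟩ := hz.exists_lift π hπ
    exact ⟨(p.prod b).codRestrict K (fun y => by simp [K, hb]), fun y => rfl⟩
  obtain ⟨a, ha⟩ := hse₂.exists_lift (k₂ ∘ₗ i) (fun x => by simp [hk₂, hse.apply_apply])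
  obtain ⟨b, hb⟩ := hse.exists_lift (k' ∘ₗ i₂) (fun x => by simp [hk', hse₂.apply_apply])
  simp only [LinearMap.comp_apply] at ha hb
  rcases HenselianLocalRing.isUnit_or_isUnit_one_sub hind (b ∘ₗ a) with hu | hu
  · obtain ⟨s, -, hs⟩ := isUnit_iff_exists.mp hu
    exact HasCosyzygy.of_retract_syzygy hC hV hπ a (s ∘ₗ b) fun x => LinearMap.congr_fun hs x
  · exfalso
    obtain ⟨s, -, hs⟩ := isUnit_iff_exists.mp hu
    -- The endomorphism $1-k'k_2$ of `Y` lands in `X` and restricts there to $1-ba$; if the latter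
    -- is invertible, `i` splits.
    obtain ⟨m, hm⟩ := hse.exists_lift (LinearMap.id - k' ∘ₗ k₂) (fun y => by simp [hk', hk₂])
    refine hns ⟨s ∘ₗ m, fun x => ?_⟩
    have : m (i x) = (1 - b ∘ₗ a : Module.End R X) x := by
      apply hse.injective
      rw [hm]
      simp [hb, ha]
    rw [LinearMap.comp_apply, this]
    exact LinearMap.congr_fun hs x

/-- Cosyzygies add up over direct sums, and `C` contains the indecomposable summands of its members.
-/
theorem IsResolving.hasCosyzygy [IsNoetherianRing R] [HenselianLocalRing R]
    (hC : IsResolving C) (hF : IsFrobeniusCategory (FinPresFunctors (StableCategory C)))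
    (hE : NoExtInjectiveNonprojective C) (X : ModuleCat.{u} R) (hX : C X) : HasCosyzygy C X := by
  have := hC.finite _ hX
  refine induction_of_indecomposable (P := fun X => C X → HasCosyzygy C X)
    (fun M N e h hN => (h (hC.of_linearEquiv e.symm hN)).of_linearEquiv e)
    (fun M _ hM hCM => hC.hasCosyzygy_of_indecomposable hF hE hCM hM)
    (fun M N hM hN h h' hMN => ?_) X hX
  obtain ⟨h1, h2⟩ := (hC.sum_iff M N hM hN).mp hMN
  exact (h h1).prod hC.toIsSubcategory (h' h2)

end Cosyzygies

/-! ### Totally reflexive modules -/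

section TotallyReflexive

variable {R : Type u} [CommRing R]

/-- The dual module as an object of the category of modules. -/
abbrev dualModule (X : ModuleCat.{u} R) : ModuleCat.{u} R := ModuleCat.of R (Module.Dual R X)

/-- Dualizing a short exact sequence whose third term has no extensions by `R`. -/
theorem IsShortExactPair.dual {A B W : ModuleCat.{u} R} {i : A →ₗ[R] B} {p : B →ₗ[R] W}
    (h : IsShortExactPair i p) (hW : ExtVanishes W (ModuleCat.of R R) 1) :
    IsShortExactPair p.dualMap i.dualMap := by
  refine ⟨LinearMap.dualMap_injective_of_surjective h.surjective, fun g => ⟨fun hg => ?_, ?_⟩,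
    fun f => ?_⟩
  · obtain ⟨f, hf⟩ := h.exists_desc g (fun x => LinearMap.congr_fun hg x)
    exact ⟨f, LinearMap.ext hf⟩
  · rintro ⟨f, rfl⟩
    ext x
    simp [h.apply_apply]
  · obtain ⟨g, hg⟩ := h.exists_extension hW f
    exact ⟨g, LinearMap.ext hg⟩

/-- Totally reflexive modules. -/
structure IsTotallyReflexive (X : ModuleCat.{u} R) : Prop where
  finite : Module.Finite R X
  ext : ∀ n, ExtVanishes X (ModuleCat.of R R) (n + 1)
  ext_dual : ∀ n, ExtVanishes (dualModule X) (ModuleCat.of R R) (n + 1)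
  torsionless : ∀ x : X, (∀ f : Module.Dual R X, f x = 0) → x = 0
  reflexive : ∀ ξ : Module.Dual R X →ₗ[R] R, ∃ x : X, ∀ f, ξ f = f x

theorem exists_eval_of_projective (P : Type*) [AddCommGroup P] [Module R P] [Module.Finite R P]
    [Module.Projective R P] (ξ : Module.Dual R P →ₗ[R] R) : ∃ x : P, ∀ f, ξ f = f x := by
  obtain ⟨x, hx⟩ := (Module.bijective_dual_eval R P).2 ξ
  exact ⟨x, fun f => by rw [← hx]; rfl⟩

theorem eq_zero_of_forall_dual_of_projective (P : Type*) [AddCommGroup P] [Module R P]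
    [Module.Finite R P] [Module.Projective R P] (x : P) (h : ∀ f : Module.Dual R P, f x = 0) :
    x = 0 :=
  (Module.bijective_dual_eval R P).1 (LinearMap.ext fun f => by simpa using h f)

namespace IsTotallyReflexive

variable {X Y Z : ModuleCat.{u} R}

theorem of_projective (P : ModuleCat.{u} R) [Module.Finite R P] [Module.Projective R P] :
    IsTotallyReflexive P where
  finite := ‹_›
  ext n := extVanishes_of_projective _ _ n
  ext_dual n :=
    have : Module.Projective R (dualModule P) :=
      inferInstanceAs (Module.Projective R (Module.Dual R P))
    extVanishes_of_projective _ _ n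
  torsionless := eq_zero_of_forall_dual_of_projective P
  reflexive := exists_eval_of_projective P

theorem of_retract (i : X →ₗ[R] Y) (r : Y →ₗ[R] X) (h : ∀ x, r (i x) = x)
    (hY : IsTotallyReflexive Y) : IsTotallyReflexive X where
  finite := have := hY.finite; Module.Finite.of_surjective r fun x => ⟨_, h x⟩
  ext n := (hY.ext n).of_retract_left i r h
  ext_dual n := (hY.ext_dual n).of_retract_left (Z := dualModule X) (Y := dualModule Y)
    r.dualMap i.dualMap fun f => LinearMap.ext fun x => congrArg f (h x)
  torsionless x hx := by
    rw [← h x, hY.torsionless (i x) fun f => hx (f ∘ₗ i), map_zero]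
  reflexive ξ := by
    obtain ⟨y, hy⟩ := hY.reflexive (ξ ∘ₗ i.dualMap)
    refine ⟨r y, fun f => ?_⟩
    have := hy (f ∘ₗ r)
    rw [LinearMap.comp_apply, LinearMap.comp_apply] at this
    rw [← this]
    congr 1
    exact LinearMap.ext fun x => (congrArg f (h x)).symm

theorem middle {i : X →ₗ[R] Y} {p : Y →ₗ[R] Z} (h : IsShortExactPair i p)
    (hX : IsTotallyReflexive X) (hZ : IsTotallyReflexive Z) : IsTotallyReflexive Y := by
  have hd := h.dual (hZ.ext 0)
  refine ⟨?_, fun n => h.extVanishes_middle (hX.ext n) (hZ.ext n), fun n => ?_, fun y hy => ?_,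
    fun ξ => ?_⟩
  · have := hX.finite
    have := hZ.finite
    exact h.finite_middle
  · exact IsShortExactPair.extVanishes_middle (A := dualModule Z) (B := dualModule Y)
      (W := dualModule X) hd (hZ.ext_dual n) (hX.ext_dual n)
  · have hz : p y = 0 := hZ.torsionless _ fun f => hy (f ∘ₗ p)
    obtain ⟨x, rfl⟩ := (h.exact y).mp hz
    rw [hX.torsionless x fun f => ?_, map_zero]
    obtain ⟨g, rfl⟩ := hd.surjective f
    exact hy g
  · obtain ⟨z, hz⟩ := hZ.reflexive (ξ ∘ₗ p.dualMap)
    obtain ⟨y, rfl⟩ := h.surjective z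
    -- After subtracting evaluation at `y`, the functional vanishes on the dual of `Z` and descends
    -- to the dual of `X`.
    obtain ⟨ζ, hζ⟩ := hd.exists_desc (ξ - Module.Dual.eval R Y y) fun f => by
      have := hz f
      rw [LinearMap.comp_apply] at this
      simp [this]
    obtain ⟨x, hx⟩ := hX.reflexive ζ
    refine ⟨y + i x, fun g => ?_⟩
    have h1 := hζ g
    rw [hx, LinearMap.sub_apply, Module.Dual.eval_apply, eq_sub_iff_add_eq] at h1
    rw [← h1, map_add, add_comm]
    rfl

theorem left [IsNoetherianRing R] {i : X →ₗ[R] Y} {p : Y →ₗ[R] Z} (h : IsShortExactPair i p)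
    (hY : IsTotallyReflexive Y) (hZ : IsTotallyReflexive Z) : IsTotallyReflexive X := by
  have hd := h.dual (hZ.ext 0)
  have := hY.finite
  refine ⟨h.finite_left, fun n => h.extVanishes_left (hY.ext n) (hZ.ext (n + 1)), fun n => ?_,
    fun x hx => h.injective ?_, fun ξ => ?_⟩
  · cases n with
    | zero =>
      refine IsShortExactPair.extVanishes_one (A := dualModule Z) (B := dualModule Y)
        (W := dualModule X) hd (hY.ext_dual 0) fun f => ?_
      -- A functional on the dual of `Z` is evaluation at a point; evaluation at a preimage in `Y`
      -- extends it.
      obtain ⟨z, hz⟩ := hZ.reflexive f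
      obtain ⟨y, rfl⟩ := h.surjective z
      exact ⟨Module.Dual.eval R Y y, fun g => (hz g).symm⟩
    | succ n =>
      exact IsShortExactPair.extVanishes_right (A := dualModule Z) (B := dualModule Y)
        (W := dualModule X) hd (hY.ext_dual (n + 1)) (hZ.ext_dual n)
  · rw [map_zero]
    exact hY.torsionless _ fun g => hx (g ∘ₗ i)
  · obtain ⟨y, hy⟩ := hY.reflexive (ξ ∘ₗ i.dualMap)
    have hz : p y = 0 := hZ.torsionless _ fun f => by
      have := hy (f ∘ₗ p)
      rw [LinearMap.comp_apply, LinearMap.comp_apply] at this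
      rw [← this]
      have h0 : i.dualMap (f ∘ₗ p) = 0 := by
        ext x
        simp [h.apply_apply]
      rw [h0, map_zero]
    obtain ⟨x, rfl⟩ := (h.exact y).mp hz
    refine ⟨x, fun f => ?_⟩
    obtain ⟨g, rfl⟩ := hd.surjective f
    exact hy g

theorem dual_finite [IsNoetherianRing R] (X : ModuleCat.{u} R) [Module.Finite R X] :
    Module.Finite R (Module.Dual R X) := by
  obtain ⟨n, π, hπ⟩ := Module.Finite.exists_fin' R X
  exact Module.Finite.of_injective π.dualMap (LinearMap.dualMap_injective_of_surjective hπ)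

theorem dual [IsNoetherianRing R] (hX : IsTotallyReflexive X) :
    IsTotallyReflexive (dualModule X) := by
  have := hX.finite
  have hfin := dual_finite X
  have hbij : Function.Bijective (Module.Dual.eval R X) := by
    refine ⟨?_, fun ξ => ?_⟩
    · rw [← LinearMap.ker_eq_bot, LinearMap.ker_eq_bot']
      exact fun x hx => hX.torsionless x fun f => LinearMap.congr_fun hx f
    · obtain ⟨x, hx⟩ := hX.reflexive ξ
      exact ⟨x, LinearMap.ext fun f => (hx f).symm⟩
  let e := LinearEquiv.ofBijective _ hbij
  refine ⟨hfin, hX.ext_dual, fun n => ?_, fun f hf => ?_, fun Ξ => ?_⟩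
  · exact (hX.ext n).of_retract_left (Z := dualModule (dualModule X)) e.symm.toLinearMap
      e.toLinearMap fun ξ => e.apply_symm_apply ξ
  · ext x
    exact hf (Module.Dual.eval R X x)
  · refine ⟨Ξ ∘ₗ Module.Dual.eval R X, fun ξ => ?_⟩
    obtain ⟨x, rfl⟩ := hbij.2 ξ
    rfl

theorem isResolving (R : Type u) [CommRing R] [IsNoetherianRing R] :
    IsResolving (IsTotallyReflexive (R := R)) where
  finite X hX := hX.finite
  of_iso X Y e hX := by
    obtain ⟨e⟩ := e
    exact of_retract e.toLinearEquiv.symm.toLinearMap e.toLinearEquiv.toLinearMap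
      (fun x => e.toLinearEquiv.apply_symm_apply x) hX
  sum_iff X Y _ _ := by
    constructor
    · intro h
      exact ⟨h.of_retract (Y := ModuleCat.of R (X × Y)) (LinearMap.inl R X Y)
          (LinearMap.fst R X Y) (fun x => rfl),
        h.of_retract (Y := ModuleCat.of R (X × Y)) (LinearMap.inr R X Y)
          (LinearMap.snd R X Y) (fun x => rfl)⟩
    · rintro ⟨hX, hY⟩
      exact middle (Y := ModuleCat.of R (X × Y)) (i := LinearMap.inl R X Y)
        (p := LinearMap.snd R X Y)
        ⟨LinearMap.inl_injective, Function.Exact.inl_snd, LinearMap.snd_surjective⟩ hX hY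
  of_projective P _ _ := of_projective P
  ext_closed _ hS _ _ _ := middle (IsShortExactPair.of_shortExact hS)
  kernel_closed _ hS _ _ _ := left (IsShortExactPair.of_shortExact hS)

/-- Dualize a free cover of the dual of `X`: reflexivity puts `X` in place of its double dual, and
the cokernel is the dual of a totally reflexive syzygy. -/
theorem hasCosyzygy [IsNoetherianRing R] (hX : IsTotallyReflexive X) :
    HasCosyzygy IsTotallyReflexive X := by
  have hX' := hX.dual
  have := hX'.finite
  obtain ⟨n, q, hq⟩ := Module.Finite.exists_fin' R (Module.Dual R X)
  have hse := IsShortExactPair.of_surjective q hq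
  have hK : IsTotallyReflexive (ModuleCat.of R (LinearMap.ker q)) :=
    left (X := ModuleCat.of R (LinearMap.ker q)) (Y := ModuleCat.of R (Fin n → R))
      (Z := dualModule X) hse ((isResolving R).free_mem n) hX'
  have hd := IsShortExactPair.dual (A := ModuleCat.of R (LinearMap.ker q))
    (B := ModuleCat.of R (Fin n → R)) (W := dualModule X) hse (hX'.ext 0)
  refine ⟨ModuleCat.of R (Module.Dual R (Fin n → R)), dualModule (ModuleCat.of R (LinearMap.ker q)),
    q.dualMap ∘ₗ Module.Dual.eval R X, (LinearMap.ker q).subtype.dualMap,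
    inferInstanceAs (Module.Finite R (Module.Dual R (Fin n → R))),
    inferInstanceAs (Module.Projective R (Module.Dual R (Fin n → R))), hK.dual,
    hd.injective.comp ?_, fun y => (hd.exact y).trans ?_, hd.surjective⟩
  · intro x y hxy
    rw [← sub_eq_zero]
    refine hX.torsionless _ fun f => ?_
    rw [map_sub, sub_eq_zero]
    exact LinearMap.congr_fun hxy f
  · constructor
    · rintro ⟨ξ, rfl⟩
      obtain ⟨x, hx⟩ := hX.reflexive ξ
      refine ⟨x, ?_⟩
      rw [LinearMap.comp_apply]
      congr 1
      exact LinearMap.ext fun f => (hx f).symm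
    · rintro ⟨x, rfl⟩
      exact ⟨Module.Dual.eval R X x, rfl⟩

end IsTotallyReflexive

/-- Resolving subcategories closed under cosyzygies, without extensions by `R`, consist of totally
reflexive modules. -/
theorem IsResolving.isTotallyReflexive {C : ObjectProperty (ModuleCat.{u} R)}
    (hC : IsResolving C)
    (hR : ∀ X, C X → ∀ n, ExtVanishes X (ModuleCat.of R R) (n + 1))
    (hcos : ∀ X, C X → HasCosyzygy C X) (X : ModuleCat.{u} R) (hX : C X) :
    IsTotallyReflexive X := by
  have torsionless : ∀ X, C X → ∀ x : X, (∀ f : Module.Dual R X, f x = 0) → x = 0 := by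
    intro X hX x hx
    obtain ⟨P, X', i, p, _, _, hX', h⟩ := hcos X hX
    apply h.injective
    rw [map_zero]
    exact eq_zero_of_forall_dual_of_projective P _ fun g => hx (g ∘ₗ i)
  have reflexive : ∀ X, C X → ∀ ξ : Module.Dual R X →ₗ[R] R, ∃ x : X, ∀ f, ξ f = f x := by
    intro X hX ξ
    obtain ⟨P, X', i, p, _, _, hX', h⟩ := hcos X hX
    have hd := h.dual (hR X' hX' 0)
    obtain ⟨y, hy⟩ := exists_eval_of_projective P (ξ ∘ₗ i.dualMap)
    -- The functional is evaluation at some `y` in `P`. All functionals on the cosyzygy vanish at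
    -- the image of `y`, so torsionlessness of the cosyzygy puts `y` in `X`.
    have hz : p y = 0 := torsionless X' hX' _ fun f => by
      have := hy (f ∘ₗ p)
      rw [LinearMap.comp_apply, LinearMap.comp_apply] at this
      rw [← this]
      have h0 : i.dualMap (f ∘ₗ p) = 0 := by
        ext x
        simp [h.apply_apply]
      rw [h0, map_zero]
    obtain ⟨x, rfl⟩ := (h.exact y).mp hz
    refine ⟨x, fun f => ?_⟩
    obtain ⟨g, rfl⟩ := hd.surjective f
    exact hy g
  have ext_dual : ∀ n X, C X → ExtVanishes (dualModule X) (ModuleCat.of R R) (n + 1) := by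
    intro n
    induction n with
    | zero =>
      intro X hX
      obtain ⟨P, X', i, p, _, _, hX', h⟩ := hcos X hX
      have hd := h.dual (hR X' hX' 0)
      refine IsShortExactPair.extVanishes_one (A := dualModule X') (B := dualModule P)
        (W := dualModule X) hd ((IsTotallyReflexive.of_projective P).ext_dual 0) fun f => ?_
      obtain ⟨z, hz⟩ := reflexive X' hX' f
      obtain ⟨y, rfl⟩ := h.surjective z
      exact ⟨Module.Dual.eval R P y, fun g => (hz g).symm⟩
    | succ n ih =>
      intro X hX
      obtain ⟨P, X', i, p, _, _, hX', h⟩ := hcos X hX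
      have hd := h.dual (hR X' hX' 0)
      -- Dimension shift along the dual sequence: extensions of the dual of `X` reduce to those of
      -- the dual of its cosyzygy in one degree lower.
      exact IsShortExactPair.extVanishes_right (A := dualModule X') (B := dualModule P)
        (W := dualModule X) hd ((IsTotallyReflexive.of_projective P).ext_dual (n + 1)) (ih X' hX')
  exact ⟨hC.finite X hX, hR X hX, fun n => ext_dual n X hX, torsionless X hX, reflexive X hX⟩

end TotallyReflexive

/-! ### G-dimension zero is total reflexivity -/

section GDimensionZero

variable {R : Type u} [CommRing R]

/-- Maps from the kernel to a finite projective module extend if `Ext¹(W, R) = 0`. -/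
theorem IsShortExactPair.exists_extension_projective {A B W : ModuleCat.{u} R} {i : A →ₗ[R] B}
    {p : B →ₗ[R] W} (h : IsShortExactPair i p) (hW : ExtVanishes W (ModuleCat.of R R) 1)
    {Q : Type*} [AddCommGroup Q] [Module R Q] [Module.Finite R Q] [Module.Projective R Q]
    (f : A →ₗ[R] Q) : ∃ g : B →ₗ[R] Q, ∀ x, g (i x) = f x := by
  obtain ⟨n, b, a, -, -, hba⟩ := Module.Finite.exists_comp_eq_id_of_projective R Q
  have hk (k : Fin n) : ∃ g : B →ₗ[R] R, ∀ x, g (i x) = a (f x) k :=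
    h.exists_extension hW (LinearMap.proj k ∘ₗ a ∘ₗ f)
  choose g hg using hk
  refine ⟨b ∘ₗ LinearMap.pi g, fun x => ?_⟩
  have : LinearMap.pi g (i x) = a (f x) := funext fun k => hg k x
  rw [LinearMap.comp_apply, this]
  exact LinearMap.congr_fun hba (f x)

namespace FinProjPresentation

variable {X : ModuleCat.{u} R} (p : FinProjPresentation X)

/-- The image of the dual of the first map of a presentation. -/
abbrev dualImage : ModuleCat.{u} R :=
  ModuleCat.of R (LinearMap.range p.d.hom.dualMap)

theorem isShortExactPair_transpose :
    IsShortExactPair (A := p.dualImage) (B := dualModule p.P₁) (W := p.transpose)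
      (LinearMap.range p.d.hom.dualMap).subtype
      (LinearMap.range p.d.hom.dualMap).mkQ :=
  ⟨Subtype.coe_injective, LinearMap.exact_subtype_mkQ _, Submodule.mkQ_surjective _⟩

theorem isShortExactPair_dual :
    IsShortExactPair (A := dualModule X) (B := dualModule p.P₀) (W := p.dualImage)
      p.e.hom.dualMap p.d.hom.dualMap.rangeRestrict := by
  refine ⟨LinearMap.dualMap_injective_of_surjective p.surjective, fun g => ⟨fun hg => ?_, ?_⟩,
    LinearMap.surjective_rangeRestrict _⟩
  · have hg : p.d.hom.dualMap g = 0 := congrArg Subtype.val hg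
    obtain ⟨f, hf⟩ := (IsShortExactPair.of_surjective p.e.hom p.surjective).exists_desc g
      (fun x => by
        obtain ⟨z, hz⟩ := (p.exact x.1).mp x.2
        change g x.1 = 0
        rw [← hz]
        exact LinearMap.congr_fun hg z)
    exact ⟨f, LinearMap.ext hf⟩
  · rintro ⟨f, rfl⟩
    ext x
    simp [p.exact.apply_apply_eq_zero]

theorem extVanishes_dual (P : ModuleCat.{u} R) (_ : Module.Finite R P)
    (_ : Module.Projective R P) (n : ℕ) :
    ExtVanishes (dualModule P) (ModuleCat.of R R) (n + 1) :=
  (IsTotallyReflexive.of_projective P).ext_dual n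

/-- Splice $0\to X^*\to P_0^*\to I\to 0$ and $0\to I\to P_1^*\to\mathrm{Tr}\,X\to 0$:
$\mathrm{Ext}^1(\mathrm{Tr}\,X,R)=0$ gives torsionlessness, $\mathrm{Ext}^2$ gives reflexivity, and
the higher groups control the Ext of $X^*$. -/
theorem isTotallyReflexive (hX : Module.Finite R X)
    (h : ∀ n, ExtVanishes X (ModuleCat.of R R) (n + 1))
    (ht : ∀ n, ExtVanishes p.transpose (ModuleCat.of R R) (n + 1)) : IsTotallyReflexive X := by
  have := p.finite₀
  have := p.finite₁
  have := p.projective₀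
  have := p.projective₁
  have hK (n : ℕ) : ExtVanishes p.dualImage (ModuleCat.of R R) (n + 1) :=
    IsShortExactPair.extVanishes_left (A := p.dualImage) (B := dualModule p.P₁)
      (W := p.transpose) p.isShortExactPair_transpose
      (extVanishes_dual _ p.finite₁ p.projective₁ n) (ht (n + 1))
  have hX' (n : ℕ) : ExtVanishes (dualModule X) (ModuleCat.of R R) (n + 1) :=
    IsShortExactPair.extVanishes_left (A := dualModule X) (B := dualModule p.P₀)
      (W := p.dualImage) p.isShortExactPair_dual
      (extVanishes_dual _ p.finite₀ p.projective₀ n) (hK (n + 1))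
  refine ⟨hX, h, hX', fun x hx => ?_, fun ξ => ?_⟩
  · obtain ⟨y, rfl⟩ := p.surjective x
    -- Evaluation at `y` kills $X^*$, so it descends to $I$ and extends to $P_1^*$. There it is
    -- evaluation at some `z`, whence $y=d(z)$.
    obtain ⟨f, hf⟩ := p.isShortExactPair_dual.exists_desc (Module.Dual.eval R p.P₀ y) hx
    obtain ⟨g, hg⟩ := IsShortExactPair.exists_extension (A := p.dualImage)
      (B := dualModule p.P₁) (W := p.transpose) p.isShortExactPair_transpose (ht 0) f
    obtain ⟨z, hz⟩ := exists_eval_of_projective p.P₁ g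
    have hy : y - p.d.hom z = 0 := eq_zero_of_forall_dual_of_projective p.P₀ _ fun k => by
      have h1 : f (p.d.hom.dualMap.rangeRestrict k) = k y := hf k
      have h2 : g (p.d.hom.dualMap k) = f (p.d.hom.dualMap.rangeRestrict k) :=
        hg (p.d.hom.dualMap.rangeRestrict k)
      have h3 : g (p.d.hom.dualMap k) = k (p.d.hom z) := hz (p.d.hom.dualMap k)
      rw [map_sub, sub_eq_zero, ← h1, ← h2, h3]
    rw [sub_eq_zero.mp hy, p.exact.apply_apply_eq_zero]
  · obtain ⟨g, hg⟩ := IsShortExactPair.exists_extension (A := dualModule X)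
      (B := dualModule p.P₀) (W := p.dualImage) p.isShortExactPair_dual (hK 0) ξ
    obtain ⟨y, hy⟩ := exists_eval_of_projective p.P₀ g
    exact ⟨p.e.hom y, fun f => by rw [← hg f]; exact hy _⟩

theorem extVanishes_transpose (hX : IsTotallyReflexive X) (n : ℕ) :
    ExtVanishes p.transpose (ModuleCat.of R R) (n + 1) := by
  have := p.finite₀
  have := p.finite₁
  have := p.projective₀
  have := p.projective₁
  have hK (n : ℕ) : ExtVanishes p.dualImage (ModuleCat.of R R) (n + 1) := by
    cases n with
    | zero =>
      refine IsShortExactPair.extVanishes_one (A := dualModule X) (B := dualModule p.P₀)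
        (W := p.dualImage) p.isShortExactPair_dual
        (extVanishes_dual _ p.finite₀ p.projective₀ 0) fun f => ?_
      obtain ⟨x, hx⟩ := hX.reflexive f
      obtain ⟨y, rfl⟩ := p.surjective x
      exact ⟨Module.Dual.eval R p.P₀ y, fun g => (hx g).symm⟩
    | succ n =>
      exact IsShortExactPair.extVanishes_right (A := dualModule X) (B := dualModule p.P₀)
        (W := p.dualImage) p.isShortExactPair_dual
        (extVanishes_dual _ p.finite₀ p.projective₀ (n + 1)) (hX.ext_dual n)
  cases n with
  | zero =>
    refine IsShortExactPair.extVanishes_one (A := p.dualImage) (B := dualModule p.P₁)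
      (W := p.transpose) p.isShortExactPair_transpose
      (extVanishes_dual _ p.finite₁ p.projective₁ 0) fun f => ?_
    obtain ⟨y, hy⟩ := exists_eval_of_projective p.P₀ (f ∘ₗ p.d.hom.dualMap.rangeRestrict)
    have h0 : p.e.hom y = 0 := hX.torsionless _ fun k => by
      refine (hy (p.e.hom.dualMap k)).symm.trans ?_
      rw [LinearMap.comp_apply, p.isShortExactPair_dual.apply_apply, map_zero]
    obtain ⟨z, rfl⟩ := (p.exact y).mp h0
    refine ⟨Module.Dual.eval R p.P₁ z, fun x => ?_⟩
    obtain ⟨k, rfl⟩ := LinearMap.surjective_rangeRestrict p.d.hom.dualMap x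
    exact (hy k).symm
  | succ n =>
    exact IsShortExactPair.extVanishes_right (A := p.dualImage) (B := dualModule p.P₁)
      (W := p.transpose) p.isShortExactPair_transpose
      (extVanishes_dual _ p.finite₁ p.projective₁ (n + 1)) (hK n)

end FinProjPresentation

theorem nonempty_finProjPresentation [IsNoetherianRing R] (X : ModuleCat.{u} R)
    [Module.Finite R X] : Nonempty (FinProjPresentation X) := by
  obtain ⟨n, π, hπ⟩ := Module.Finite.exists_fin' R X
  obtain ⟨m, ρ, hρ⟩ := Module.Finite.exists_fin' R (LinearMap.ker π)
  exact ⟨{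
    P₁ := ModuleCat.of R (Fin m → R)
    P₀ := ModuleCat.of R (Fin n → R)
    d := ModuleCat.ofHom ((LinearMap.ker π).subtype ∘ₗ ρ)
    e := ModuleCat.ofHom π
    finite₁ := inferInstanceAs (Module.Finite R (Fin m → R))
    finite₀ := inferInstanceAs (Module.Finite R (Fin n → R))
    projective₁ := inferInstanceAs (Module.Projective R (Fin m → R))
    projective₀ := inferInstanceAs (Module.Projective R (Fin n → R))
    exact := fun y => by
      constructor
      · intro hy
        obtain ⟨z, hz⟩ := hρ ⟨y, hy⟩
        exact ⟨z, congrArg Subtype.val hz⟩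
      · rintro ⟨z, rfl⟩
        exact (ρ z).2
    surjective := hπ }⟩

theorem gDimZero_eq [IsNoetherianRing R] :
    GDimZero R = (IsTotallyReflexive : ObjectProperty (ModuleCat.{u} R)) := by
  funext X
  refine propext ⟨fun ⟨hX, h, p, hp⟩ => p.isTotallyReflexive hX (fun n => h _ n.succ_pos)
    fun n => hp _ n.succ_pos, fun hX => ?_⟩
  have := hX.finite
  obtain ⟨p⟩ := nonempty_finProjPresentation X
  refine ⟨hX.finite, fun i hi => ?_, p, fun i hi => ?_⟩
  · obtain ⟨n, rfl⟩ := Nat.exists_eq_succ_of_ne_zero hi.ne'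
    exact hX.ext n
  · obtain ⟨n, rfl⟩ := Nat.exists_eq_succ_of_ne_zero hi.ne'
    exact p.extVanishes_transpose hX n

end GDimensionZero

/-! ### Totally reflexive modules have the Frobenius property -/

section FrobeniusTotallyReflexive

variable {R : Type u} [CommRing R]

/-- The pushout sequence of a map along the kernel inclusion of a short exact sequence. -/
theorem IsShortExactPair.exists_pushout {A B W V : ModuleCat.{u} R} {i : A →ₗ[R] B}
    {p : B →ₗ[R] W} (h : IsShortExactPair i p) (f : A →ₗ[R] V) :
    ∃ (N : ModuleCat.{u} R) (q : (V × B) →ₗ[R] N) (a : V →ₗ[R] N) (b : N →ₗ[R] W),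
      IsShortExactPair (f.prod i) q ∧ IsShortExactPair a b := by
  let L := LinearMap.range (f.prod i)
  let b : ((V × B) ⧸ L) →ₗ[R] W := L.liftQ (p ∘ₗ LinearMap.snd R V B) (by
    rintro _ ⟨x, rfl⟩
    simp [h.apply_apply])
  refine ⟨ModuleCat.of R ((V × B) ⧸ L), L.mkQ, L.mkQ ∘ₗ LinearMap.inl R V B, b,
    ⟨fun x y hxy => h.injective (congrArg Prod.snd hxy), fun y => ?_, L.mkQ_surjective⟩,
    ⟨?_, ?_, fun w => ?_⟩⟩
  · exact Submodule.Quotient.mk_eq_zero L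
  · rw [← LinearMap.ker_eq_bot, LinearMap.ker_eq_bot']
    intro v hv
    obtain ⟨x, hx⟩ := (Submodule.Quotient.mk_eq_zero L).mp hv
    have h1 : f x = v := congrArg Prod.fst hx
    have h2 : i x = 0 := congrArg Prod.snd hx
    rw [← h1, h.injective (h2.trans (map_zero i).symm), map_zero]
  · intro y
    obtain ⟨⟨v, y⟩, rfl⟩ := L.mkQ_surjective y
    constructor
    · intro hy
      obtain ⟨x, rfl⟩ := (h.exact y).mp hy
      exact ⟨v - f x, (Submodule.Quotient.eq L).mpr ⟨-x, by simp⟩⟩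
    · rintro ⟨v', hv'⟩
      rw [← hv']
      simp [b]
  · obtain ⟨y, rfl⟩ := h.surjective w
    exact ⟨L.mkQ (0, y), rfl⟩

namespace IsTotallyReflexive

variable [IsNoetherianRing R] {X Y : ModuleCat.{u} R}

/-- Adding an embedding of `Y` in a projective `Q` makes `p` injective with totally reflexive
cokernel `N`. The stable monomorphism condition makes the rotated map $\Omega N\to Y$ stably zero,
which splits the enlarged sequence. -/
theorem exists_stable_retraction (hY : IsTotallyReflexive Y) (hX : IsTotallyReflexive X)
    (p : Y →ₗ[R] X) (hp : ∀ (U : ModuleCat.{u} R) (_ : IsTotallyReflexive U) (g : U →ₗ[R] Y),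
      (p ∘ₗ g).IsStablyZero → g.IsStablyZero) :
    ∃ q : X →ₗ[R] Y, (q ∘ₗ p - LinearMap.id).IsStablyZero := by
  obtain ⟨Q, Z, i, c, _, _, hZ, h⟩ := hY.hasCosyzygy
  obtain ⟨N, m, a, b, hm, hab⟩ := h.exists_pushout p
  have hN : IsTotallyReflexive N := middle hab hX hZ
  have := hN.finite
  obtain ⟨n, π, hπ⟩ := Module.Finite.exists_fin' R N
  have hK := IsShortExactPair.of_surjective π hπ
  have hKR : IsTotallyReflexive (ModuleCat.of R (LinearMap.ker π)) :=
    left (X := ModuleCat.of R (LinearMap.ker π)) (Y := ModuleCat.of R (Fin n → R)) hK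
      ((isResolving R).free_mem n) hN
  obtain ⟨t, s, hs, hts, -⟩ := hm.exists_rotation hK
  have ht : t.IsStablyZero := by
    refine hp (ModuleCat.of R (LinearMap.ker π)) hKR t ⟨n, (LinearMap.ker π).subtype,
      LinearMap.fst R X Q ∘ₗ s, LinearMap.ext fun x => ?_⟩
    exact congrArg Prod.fst (hts x).symm
  obtain ⟨k, u, v, rfl⟩ := ht
  -- The factorization of `t` through a free module extends over the free cover of `N` because
  -- $\mathrm{Ext}^1(N,R)=0$; subtracting it makes `s` descend to a section `σ` of `m`.
  obtain ⟨u', hu'⟩ := IsShortExactPair.exists_extension_projective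
    (A := ModuleCat.of R (LinearMap.ker π)) (B := ModuleCat.of R (Fin n → R)) hK (hN.ext 0) u
  obtain ⟨σ, hσ⟩ := hK.exists_desc (s - p.prod i ∘ₗ v ∘ₗ u') (fun x => by
    have h1 := hts x
    have h2 : u' ((LinearMap.ker π).subtype x) = u x := hu' x
    rw [LinearMap.sub_apply, ← h1]
    refine sub_eq_zero.mpr (congrArg (fun z => p.prod i (v z)) h2.symm))
  have hσm (y : N) : m (σ y) = y := by
    obtain ⟨z, rfl⟩ := hπ y
    rw [hσ, LinearMap.sub_apply, map_sub, hs, LinearMap.comp_apply, hm.apply_apply, sub_zero]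
  obtain ⟨r, hr⟩ := hm.exists_lift (LinearMap.id - σ ∘ₗ m) (fun x => by
    rw [LinearMap.sub_apply, map_sub, LinearMap.comp_apply, hσm]
    exact sub_self _)
  have hrp (y : Y) : r (p y, i y) = y := hm.injective (by
    rw [hr]
    have : m (p y, i y) = 0 := hm.apply_apply y
    simp [this])
  refine ⟨r ∘ₗ LinearMap.inl R X Q, ?_⟩
  have : (r ∘ₗ LinearMap.inl R X Q) ∘ₗ p - LinearMap.id = (-(r ∘ₗ LinearMap.inr R X Q)) ∘ₗ i := by
    ext y
    have h1 := hrp y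
    have h2 : ((p y, i y) : X × Q) = (p y, 0) + (0, i y) := by simp
    rw [h2, map_add] at h1
    simp only [LinearMap.sub_apply, LinearMap.comp_apply, LinearMap.neg_apply, LinearMap.id_apply,
      LinearMap.inl_apply, LinearMap.inr_apply]
    rw [sub_eq_iff_eq_add, neg_add_eq_sub, eq_sub_iff_add_eq, h1]
  rw [this]
  exact (LinearMap.IsStablyZero.of_projective_source _).comp_right i

/-- `V` is a cosyzygy of the kernel of `f` enlarged by a free cover, and `v` is the connecting map,
defined because $\mathrm{Ext}^1(X,R)=0$. -/
theorem exists_stable_weakCokernel (hY : IsTotallyReflexive Y) (hX : IsTotallyReflexive X)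
    (f : Y →ₗ[R] X) : ∃ (V : ModuleCat.{u} R) (_ : IsTotallyReflexive V) (v : X →ₗ[R] V),
      ∀ (U : ModuleCat.{u} R) (_ : IsTotallyReflexive U) (g : U →ₗ[R] X),
        (v ∘ₗ g).IsStablyZero ↔ ∃ k : U →ₗ[R] Y, (f ∘ₗ k - g).IsStablyZero := by
  have := hX.finite
  obtain ⟨n, π, hπ⟩ := Module.Finite.exists_fin' R X
  let f' : (Y × (Fin n → R)) →ₗ[R] X := f.coprod π
  have hf' := IsShortExactPair.of_surjective f' (fun x => by
    obtain ⟨z, rfl⟩ := hπ x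
    exact ⟨(0, z), by simp [f']⟩)
  have hB : IsTotallyReflexive (ModuleCat.of R (Y × (Fin n → R))) :=
    (isResolving R).prod_mem (Y := ModuleCat.of R (Fin n → R)) hY ((isResolving R).free_mem n)
  have hK : IsTotallyReflexive (ModuleCat.of R (LinearMap.ker f')) :=
    left (X := ModuleCat.of R (LinearMap.ker f')) (Y := ModuleCat.of R (Y × (Fin n → R))) hf' hB hX
  obtain ⟨Q, V, i, c, _, _, hV, h⟩ := hK.hasCosyzygy
  obtain ⟨j, hj⟩ := IsShortExactPair.exists_extension_projective
    (A := ModuleCat.of R (LinearMap.ker f')) (B := ModuleCat.of R (Y × (Fin n → R))) hf'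
    (hX.ext 0) i
  replace hj (x : LinearMap.ker f') : j (x : Y × (Fin n → R)) = i x := hj x
  obtain ⟨v, hv⟩ := hf'.exists_desc (c ∘ₗ j) (fun x => by
    change c (j (x : Y × (Fin n → R))) = 0
    rw [hj, h.apply_apply])
  refine ⟨V, hV, v, fun U _ g => ⟨fun hg => ?_, ?_⟩⟩
  · obtain ⟨l, -, hl⟩ := hg.exists_lift c h.surjective
    have hk (x : U) : ∃ y : Y × (Fin n → R), f' y = g x ∧ j y = l x := by
      obtain ⟨y, hy⟩ := hf'.surjective (g x)
      have : c (l x - j y) = 0 := by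
        have := hv y
        rw [map_sub, hl, LinearMap.comp_apply, ← hy, this, LinearMap.comp_apply, sub_self]
      obtain ⟨z, hz⟩ := (h.exact _).mp this
      have hz' : f' (z : Y × (Fin n → R)) = 0 := z.2
      exact ⟨y + z, by rw [map_add, hy, hz', add_zero], by rw [map_add, hj, hz]; abel⟩
    -- Via `(f', j)` the middle term embeds in the pullback of `v` and `c`, and by `hk` the image
    -- contains every `(g x, l x)`, so the lift `l` yields a map from `U`.
    have hinj : Function.Injective (f'.prod j) := by
      rw [← LinearMap.ker_eq_bot, LinearMap.ker_eq_bot']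
      intro y hy
      have h1 : f' y = 0 := congrArg Prod.fst hy
      have h2 : j y = 0 := congrArg Prod.snd hy
      have h3 := hj ⟨y, h1⟩
      rw [h2] at h3
      have h4 : (⟨y, h1⟩ : LinearMap.ker f') = 0 := h.injective (by rw [← h3, map_zero])
      exact congrArg Subtype.val h4
    let e := LinearEquiv.ofInjective (f'.prod j) hinj
    let k : U →ₗ[R] Y × (Fin n → R) := e.symm.toLinearMap ∘ₗ
      (g.prod l).codRestrict (LinearMap.range (f'.prod j)) (fun x => by
        obtain ⟨y, h1, h2⟩ := hk x
        exact ⟨y, Prod.ext h1 h2⟩)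
    have hfk (x : U) : f (k x).1 + π (k x).2 = g x :=
      congrArg (fun y : LinearMap.range (f'.prod j) => (y : X × Q).1) (e.apply_symm_apply _)
    refine ⟨LinearMap.fst R Y (Fin n → R) ∘ₗ k, n, LinearMap.snd R Y (Fin n → R) ∘ₗ k, -π,
      LinearMap.ext fun x => ?_⟩
    simp only [LinearMap.sub_apply, LinearMap.comp_apply, LinearMap.neg_apply,
      LinearMap.fst_apply, LinearMap.snd_apply]
    rw [← hfk x]
    abel
  · rintro ⟨k, hk⟩
    have : v ∘ₗ g = c ∘ₗ (j ∘ₗ LinearMap.inl R Y (Fin n → R) ∘ₗ k) + (-v) ∘ₗ (f ∘ₗ k - g) := by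
      ext x
      have h1 : v (f (k x)) = c (j (k x, 0)) := by
        have := hv (k x, 0)
        simpa [f'] using this
      simp [h1]
    rw [this]
    exact ((LinearMap.IsStablyZero.of_projective_target _).comp_left c).add (hk.comp_left (-v))

theorem isFrobeniusCategory (R : Type u) [CommRing R] [IsNoetherianRing R] :
    IsFrobeniusCategory (FinPresFunctors (StableCategory (IsTotallyReflexive (R := R)))) :=
  (isResolving R).isFrobeniusCategory
    (fun _ _ hY hX p hp => exists_stable_retraction hY hX p hp)
    (fun _ _ hY hX f => exists_stable_weakCokernel hY hX f)

end IsTotallyReflexive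

end FrobeniusTotallyReflexive

/-! ### The inclusion in modules of G-dimension zero and the Auslander–Reiten conjecture -/

section AuslanderReitenConjecture

variable {R : Type u} [CommRing R] [IsNoetherianRing R] {C : ObjectProperty (ModuleCat.{u} R)}

theorem IsResolving.le_gDimZero [HenselianLocalRing R] (hC : IsResolving C)
    (hF : IsFrobeniusCategory (FinPresFunctors (StableCategory C)))
    (hE : NoExtInjectiveNonprojective C) : C ≤ GDimZero R := by
  rw [gDimZero_eq]
  exact hC.isTotallyReflexive (fun X hX n => hC.extVanishes_ring hF hX n)
    (hC.hasCosyzygy hF hE)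

/-- A module without first extensions from `C` has none in any positive degree, in particular from
itself; with vanishing Ext into `R` this is the hypothesis of the conjecture. -/
theorem AuslanderReiten.noExtInjectiveNonprojective [IsLocalRing R] (hR : AuslanderReiten R)
    (hC : IsResolving C) (hF : IsFrobeniusCategory (FinPresFunctors (StableCategory C))) :
    NoExtInjectiveNonprojective C := by
  rintro ⟨X, hX, hP, hE⟩
  refine hP (hR X (hC.finite X hX) fun i hi => ?_)
  obtain ⟨n, rfl⟩ := Nat.exists_eq_succ_of_ne_zero hi.ne'
  exact (hC.extVanishes_of_one hE n X hX).prod_right (Z := ModuleCat.of R R)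
    (hC.extVanishes_ring hF hX n)

end AuslanderReitenConjecture

theorem mainTheorem5 (R : Type u) [CommRing R] [IsNoetherianRing R] [HenselianLocalRing R] :
    (∀ C : ObjectProperty (ModuleCat.{u} R),
      IsResolving C →
      IsFrobeniusCategory (FinPresFunctors (StableCategory C)) →
      NoExtInjectiveNonprojective C →
      C ≤ GDimZero R) ∧
    (AuslanderReiten R →
      (∀ C : ObjectProperty (ModuleCat.{u} R),
        IsResolving C →
        IsFrobeniusCategory (FinPresFunctors (StableCategory C)) →
        NoExtInjectiveNonprojective C) ∧
      IsGreatest {C : ObjectProperty (ModuleCat.{u} R) |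
        IsResolving C ∧ IsFrobeniusCategory (FinPresFunctors (StableCategory C))}
        (GDimZero R)) := by
  refine ⟨fun C hC hF hE => hC.le_gDimZero hF hE,
    fun hR => ⟨fun C hC hF => hR.noExtInjectiveNonprojective hC hF, ?_, ?_⟩⟩
  · rw [gDimZero_eq]
    exact ⟨IsTotallyReflexive.isResolving R, IsTotallyReflexive.isFrobeniusCategory R⟩
  · rintro C ⟨hC, hF⟩
    exact hC.le_gDimZero hF (hR.noExtInjectiveNonprojective hC hF)
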